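/- Let $p$ be a prime and $n\ge 0$ an integer. Let $\mathcal L_n$ be the topological poset whose objects are the proper unordered decompositions $\lambda=\{v_1,\dots,v_m\}$, $m>1$, of $\mathbb C^n$ into nonzero mutually orthogonal subspaces, topologized as a subspace of $$\coprod_{m>1}\Bigl[\Bigl(\coprod_{k\ge 1}\mathrm{Gr}_k(\mathbb C^n)\Bigr)^{m}/\Sigma_m\Bigr],$$ with a unique morphism $\lambda\to\mu$ whenever $\mu$ is a coarsening of $\lambda$ (every subspace in $\lambda$ is contained in some subspace in $\mu$) and no other morphisms; spaces of morphisms and of composable chains carry the subspace topology of the products of copies of the object space. For a closed subgroup $H\subseteq U(n)$ let $(\mathcal L_n)^H$ be the full topological subposet of those $\lambda$ whose set of subspaces $\{v_1,\dots,v_m\}$ is stabilized as a set by every element of $H$ (the subspaces may be permuted), and also write $(\mathcal L_n)^H$ for the geometric realization of its nerve, a simplicial space. **Theorem.** Let $H$ be a closed subgroup of $U(n)$ that is $p$-toral, i.e. an extension $1\to T\to H\to P\to 1$ of a finite $p$-group $P$ by a torus $T\cong (S^1)^r$, $r\ge 0$. If the space $(\mathcal L_n)^H$ is not contractible, then the image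 of $H$ in $PU(n)=U(n)/S^1$ is a (finite, possibly trivial) elementary abelian $p$-group, i.e. $H$ is projective elementary abelian. (The empty space is not contractible.) -/

import Mathlib

noncomputable section

/-- Complex `n`-space with its standard Hermitian inner product. -/
abbrev CSpace (n : ℕ) : Type := EuclideanSpace ℂ (Fin n)

/-- The unitary group `U(n)`, topologized as a subspace of the space of matrices. -/
abbrev UGroup (n : ℕ) : Type := Matrix.unitaryGroup (Fin n) ℂ

/-! ### The space of objects of the unitary partition complex -/

/-- The Grassmannian of complex `k`-planes in `ℂⁿ`. -/
def Gr (n k : ℕ) : Type := {V : Submodule ℂ (CSpace n) // Module.finrank ℂ V = k}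

/-- The usual topology of the Grassmannian: a plane is identified with the orthogonal projection
onto it, viewed as an operator on `ℂⁿ`. -/
instance Gr.instTopologicalSpace (n k : ℕ) : TopologicalSpace (Gr n k) :=
  TopologicalSpace.induced (fun V : Gr n k => V.1.starProjection) inferInstance

/-- The disjoint union of the Grassmannians of `k`-planes in `ℂⁿ` over all `k ≥ 1`. -/
abbrev GrPos (n : ℕ) : Type := Σ k : {k : ℕ // 1 ≤ k}, Gr n k.1

/-- The subspace of `ℂⁿ` underlying a point of `GrPos n`. -/
def GrPos.space {n : ℕ} (V : GrPos n) : Submodule ℂ (CSpace n) := V.2.1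

/-- Two `m`-tuples are equivalent if they differ by a permutation of the indices. -/
def permSetoid (α : Type) (m : ℕ) : Setoid (Fin m → α) where
  r v w := ∃ σ : Equiv.Perm (Fin m), w = v ∘ σ
  iseqv :=
    { refl := fun _ => ⟨1, rfl⟩
      symm := by
        rintro v _ ⟨σ, rfl⟩
        exact ⟨σ⁻¹, by funext i; simp⟩
      trans := by
        rintro v _ _ ⟨σ, rfl⟩ ⟨τ, rfl⟩
        exact ⟨σ * τ, rfl⟩ }

/-- The quotient of `αᵐ` by the symmetric group, with the quotient topology when `α` is a space. -/
abbrev UnorderedTuple (α : Type) (m : ℕ) : Type := Quotient (permSetoid α m)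

/-- The disjoint union over `m > 1` of the spaces of unordered `m`-tuples of nonzero subspaces of
`ℂⁿ`, with the disjoint union topology. -/
abbrev SubspaceFamily (n : ℕ) : Type := Σ m : {m : ℕ // 1 < m}, UnorderedTuple (GrPos n) m.1

/-- The family consists of mutually orthogonal subspaces that together span `ℂⁿ`. -/
def SubspaceFamily.IsDecomposition {n : ℕ} (F : SubspaceFamily n) : Prop :=
  ∃ v : Fin F.1.1 → GrPos n, Quotient.mk (permSetoid (GrPos n) F.1.1) v = F.2 ∧
    (∀ i j, i ≠ j → (v i).space ⟂ (v j).space) ∧ ⨆ i, (v i).space = ⊤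

/-- The space of objects of the unitary partition complex: proper unordered decompositions of `ℂⁿ`
into nonzero mutually orthogonal subspaces, topologized as a subspace of `SubspaceFamily n`. -/
abbrev UPartition (n : ℕ) : Type := {F : SubspaceFamily n // F.IsDecomposition}

/-- The set of subspaces that occur in a partition. -/
def UPartition.classes {n : ℕ} (l : UPartition n) : Set (Submodule ℂ (CSpace n)) :=
  Quotient.lift (fun v : Fin l.1.1.1 → GrPos n => Set.range fun i => (v i).space)
    (by
      rintro v _ ⟨σ, rfl⟩
      exact (σ.surjective.range_comp fun i => (v i).space).symm) l.1.2

/-- The category structure: there is a (unique) morphism `l ⟶ l'` if and only if `l'` is a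
coarsening of `l`. -/
instance UPartition.instPreorder (n : ℕ) : Preorder (UPartition n) where
  le l l' := ∀ v ∈ l.classes, ∃ w ∈ l'.classes, v ≤ w
  le_refl _ v hv := ⟨v, hv, le_rfl⟩
  le_trans _ _ _ h h' v hv := by
    obtain ⟨w, hw, hvw⟩ := h v hv
    obtain ⟨u, hu, hwu⟩ := h' w hw
    exact ⟨u, hu, hvw.trans hwu⟩

/-! ### Nerve and realization of a topological preorder -/

/-- The `m`-simplices of the nerve of a preorder `X`: chains `x₀ ≤ ⋯ ≤ xₘ`. If `X` is a topological
space, they carry the subspace topology from `X^(m+1)`. -/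
abbrev NerveSimplex (X : Type) [Preorder X] (m : ℕ) : Type :=
  {c : Fin (m + 1) → X // Monotone c}

/-- The simplicial operator of the nerve induced by a monotone map `[k] → [m]`. -/
def NerveSimplex.pullback {X : Type} [Preorder X] {k m : ℕ} (c : NerveSimplex X m)
    (θ : Fin (k + 1) →o Fin (m + 1)) : NerveSimplex X k :=
  ⟨c.1 ∘ θ, c.2.comp θ.monotone⟩

/-- The disjoint union of the spaces `N(X)ₘ × Δᵐ`. -/
abbrev PreRealization (X : Type) [Preorder X] : Type :=
  Σ m : ℕ, NerveSimplex X m × stdSimplex ℝ (Fin (m + 1))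

/-- The gluing relation of the geometric realization: `(θ^* c, t) ∼ (c, θ_* t)` for every operator
`θ : [k] → [m]` of the simplex category. -/
inductive RealizationRel (X : Type) [Preorder X] : PreRealization X → PreRealization X → Prop
  | glue {k m : ℕ} (θ : Fin (k + 1) →o Fin (m + 1)) (c : NerveSimplex X m)
      (t : stdSimplex ℝ (Fin (k + 1))) :
      RealizationRel X ⟨k, c.pullback θ, t⟩ ⟨m, c, stdSimplex.map θ t⟩

/-- The geometric realization of the nerve (a simplicial space) of a topological preorder, with the
quotient topology. -/
abbrev NerveRealization (X : Type) [Preorder X] : Type := Quot (RealizationRel X)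

/-! ### Fixed points -/

/-- A partition is weakly fixed by `H` if every element of `H` maps its set of subspaces onto itself
(possibly permuting the subspaces). -/
def UPartition.IsWeaklyFixed {n : ℕ} (H : Subgroup (UGroup n)) (l : UPartition n) : Prop :=
  ∀ h ∈ H, (fun V : Submodule ℂ (CSpace n) =>
    V.map (Matrix.toEuclideanLin (h : Matrix (Fin n) (Fin n) ℂ))) '' l.classes = l.classes

/-- The full topological subcategory of the unitary partition complex on the weakly `H`-fixed
partitions, with the subspace topology and the order by coarsening. -/
abbrev FixedPartition {n : ℕ} (H : Subgroup (UGroup n)) : Type :=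
  {l : UPartition n // l.IsWeaklyFixed H}

/-- The fixed point space of `H` on the unitary partition complex. -/
abbrev FixedSpace {n : ℕ} (H : Subgroup (UGroup n)) : Type :=
  NerveRealization (FixedPartition H)

/-! ### Group theory -/

/-- A topological group is `p`-toral if it is an extension of a finite `p`-group by a torus
`(S¹)^r`. -/
def IsPToral (p : ℕ) (G : Type) [Group G] [TopologicalSpace G] : Prop :=
  ∃ (T : Subgroup G) (_ : T.Normal), (∃ r : ℕ, Nonempty (T ≃ₜ* (Fin r → Circle))) ∧
    Finite (G ⧸ T) ∧ IsPGroup p (G ⧸ T)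

/-- An elementary abelian `p`-group: a finite abelian group in which every `p`-th power is trivial
(the trivial group is allowed). -/
def IsElementaryAbelian (p : ℕ) (G : Type) [Group G] : Prop :=
  Finite G ∧ (∀ x y : G, x * y = y * x) ∧ ∀ x : G, x ^ p = 1

/-- The central subgroup `S¹` of scalar matrices in `U(n)`. -/
def scalarCircle (n : ℕ) : Subgroup (UGroup n) where
  carrier := {A | ∃ z : Circle, (A : Matrix (Fin n) (Fin n) ℂ) = (z : ℂ) • 1}
  one_mem' := ⟨1, by simp⟩
  mul_mem' := by
    rintro A B ⟨z, hz⟩ ⟨w, hw⟩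
    exact ⟨z * w, by simp [hz, hw, smul_smul, mul_comm]⟩
  inv_mem' := by
    rintro A ⟨z, hz⟩
    refine ⟨z⁻¹, ?_⟩
    rw [Matrix.UnitaryGroup.inv_val, hz, star_smul, star_one, Circle.coe_inv_eq_conj]
    rfl

instance scalarCircle_normal (n : ℕ) : (scalarCircle n).Normal where
  conj_mem := by
    rintro A ⟨z, hz⟩ g
    refine ⟨z, ?_⟩
    have h : (g * A * g⁻¹ : UGroup n) = A := by
      have hc : g * A = A * g := by
        apply Subtype.ext
        simp [hz]
      rw [hc, mul_inv_cancel_right]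
    rw [h, hz]

/-- The projective unitary group `PU(n) = U(n)/S¹`. -/
abbrev PUGroup (n : ℕ) : Type := UGroup n ⧸ scalarCircle n

/-- The image of a subgroup of `U(n)` in `PU(n)`. -/
def projImage {n : ℕ} (H : Subgroup (UGroup n)) : Subgroup (PUGroup n) :=
  H.map (QuotientGroup.mk' (scalarCircle n))

end

/-! The argument is by contraposition. If the image of `H` in `PU(n)` is not elementary abelian,
then `H` contains a nonscalar `g` with `g ^ p` scalar that is central in `H` modulo scalars and lies
in the Frattini-type subgroup generated, modulo scalars, by commutators and `p`-th powers
(`exists_central_of_not_isElementaryAbelian`). When the torus has trivial image, the projective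
image is a finite `p`-group whose nontrivial Frattini subgroup meets the centre. Otherwise a
conjugation-fixed element of order `p` exists inside the image of the torus, and it is a `p`-th
power because that image is divisible.

Such a `g` never permutes the classes of a weakly fixed decomposition transitively
(`exists_not_same_orbit`). If it did, every element of `H`, commuting with `g`, would act on the
classes as a power of `g`; commutators and `p`-th powers would then act trivially, hence so would
`g`, although there are at least two classes.

So for each `l` the sums over `g`-orbits of classes form a proper decomposition `G l`. Its members
are `g`-invariant, hence split into eigenspaces of `g`, giving a refinement `R l`, which also
refines the eigenspace decomposition `E` of `g`. Centrality modulo scalars makes `H` permute orbit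
spans and eigenspaces, so all of these are weakly fixed, and `l ≤ G l ≥ R l ≤ E` is a zigzag of
monotone maps from the identity to a constant.

Two topological facts turn the zigzag into a contraction. Comparable continuous monotone maps have
homotopic realizations (`homotopic_of_le`), by an explicit prism homotopy on the realization of the
simplicial space. The maps `G` and `R` are continuous because equal-or-orthogonal families of
subspaces have locally constant coincidence patterns (`continuousAt_of_family`,
`continuous_of_tupleOver`). -/

open Topology commutatorElement

noncomputable section

/-! ### Homotopies of realizations -/

/-- The simplex of the nerve of `Y` induced by a simplex of the nerve of `X` and a monotone map. -/
def NerveSimplex.map {X Y : Type} [Preorder X] [Preorder Y] {f : X → Y} (hf : Monotone f) {m : ℕ}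
    (c : NerveSimplex X m) : NerveSimplex Y m :=
  ⟨f ∘ c.1, hf.comp c.2⟩

/-- The chain `f c₀ ≤ ⋯ ≤ f cᵢ ≤ g cᵢ ≤ ⋯ ≤ g cₘ`. -/
def prismFun {X Y : Type} (f g : X → Y) {m : ℕ} (i : Fin (m + 1)) (c : Fin (m + 1) → X) :
    Fin (m + 1 + 1) → Y :=
  fun l => if l ≤ i.castSucc then f (c (i.predAbove l)) else g (c (i.predAbove l))

theorem prismFun_monotone {X Y : Type} [Preorder X] [Preorder Y] {f g : X → Y} (hf : Monotone f)
    (hg : Monotone g) (hfg : ∀ x, f x ≤ g x) {m : ℕ} (i : Fin (m + 1)) {c : Fin (m + 1) → X}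
    (hc : Monotone c) : Monotone (prismFun f g i c) := by
  intro a b hab
  have h := hc (Fin.predAbove_right_monotone i hab)
  unfold prismFun
  split_ifs with ha hb hb
  · exact hf h
  · exact (hf h).trans (hfg _)
  · exact absurd (hab.trans hb) ha
  · exact hg h

/-- Vertices of weight zero contribute nothing to a pushforward, so vertex maps may be compared on
the support alone. -/
theorem FunOnFinite.linearMap_congr {A B : Type} [Fintype A] [Fintype B] {φ ψ : A → B} {v : A → ℝ}
    (h : ∀ a, v a ≠ 0 → φ a = ψ a) :
    FunOnFinite.linearMap ℝ ℝ φ v = FunOnFinite.linearMap ℝ ℝ ψ v := by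
  classical
  ext b
  rw [FunOnFinite.linearMap_apply_apply, FunOnFinite.linearMap_apply_apply,
    Finset.sum_filter, Finset.sum_filter]
  refine Finset.sum_congr rfl fun a _ => ?_
  by_cases ha : v a = 0
  · simp [ha]
  · rw [h a ha]

theorem FunOnFinite.sum_linearMap {A B : Type} [Fintype A] [Fintype B] (φ : A → B) (v : A → ℝ) :
    ∑ b, FunOnFinite.linearMap ℝ ℝ φ v b = ∑ a, v a := by
  classical
  simp only [FunOnFinite.linearMap_apply_apply]
  exact Finset.sum_fiberwise Finset.univ φ v

namespace NerveRealization

open unitInterval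

variable {X Y : Type} [Preorder X] [Preorder Y]

/-- The point of the realization with given simplex and barycentric coordinates. -/
def point {m : ℕ} (c : NerveSimplex X m) (t : stdSimplex ℝ (Fin (m + 1))) : NerveRealization X :=
  Quot.mk _ ⟨m, c, t⟩

theorem point_pullback {k m : ℕ} (θ : Fin (k + 1) →o Fin (m + 1)) (c : NerveSimplex X m)
    (t : stdSimplex ℝ (Fin (k + 1))) : point (c.pullback θ) t = point c (stdSimplex.map θ t) :=
  Quot.sound (.glue θ c t)

/-- A point of the realization only depends on the vertices of positive weight. -/
theorem point_congr {m : ℕ} {c c' : NerveSimplex X m} {t : stdSimplex ℝ (Fin (m + 1))}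
    (h : ∀ l, t l ≠ 0 → c.1 l = c'.1 l) : point c t = point c' t := by
  classical
  -- Restrict to the face spanned by the support of `t`: the two chains agree there, and `t` is
  -- pushed forward from that face.
  set S : Finset (Fin (m + 1)) := Finset.univ.filter fun l => t l ≠ 0 with hS
  have hne : S.Nonempty := by
    by_contra hemp
    rw [Finset.not_nonempty_iff_eq_empty, Finset.filter_eq_empty_iff] at hemp
    have h1 := stdSimplex.sum_eq_one t
    rw [Finset.sum_eq_zero fun l hl => not_not.1 (hemp hl)] at h1
    exact zero_ne_one h1
  obtain ⟨k, hk⟩ := Nat.exists_eq_succ_of_ne_zero hne.card_pos.ne'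
  let θ : Fin (k + 1) →o Fin (m + 1) := (S.orderEmbOfFin hk).toOrderHom
  have hθ : Function.Injective θ := (S.orderEmbOfFin hk).injective
  have hrange : ∀ l, t l ≠ 0 → ∃ j, θ j = l := by
    intro l hl
    have hlS : l ∈ Set.range (S.orderEmbOfFin hk) := by
      rw [Finset.range_orderEmbOfFin]; simpa [hS] using hl
    exact hlS
  have hval : FunOnFinite.linearMap ℝ ℝ θ (fun j => t (θ j)) = t := by
    ext l
    rw [FunOnFinite.linearMap_apply_apply]
    by_cases hl : t l = 0
    · rw [hl]
      refine Finset.sum_eq_zero fun j hj => ?_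
      rw [(Finset.mem_filter.1 hj).2, hl]
    · obtain ⟨j, rfl⟩ := hrange l hl
      rw [Finset.sum_eq_single j]
      · intro j' hj' hne'
        exact absurd (hθ (Finset.mem_filter.1 hj').2) hne'
      · simp
  have hsum := FunOnFinite.sum_linearMap θ (fun j => t (θ j))
  rw [hval, stdSimplex.sum_eq_one] at hsum
  let t' : stdSimplex ℝ (Fin (k + 1)) :=
    ⟨fun j => t (θ j), fun j => stdSimplex.zero_le t _, hsum.symm⟩
  have ht : stdSimplex.map θ t' = t := stdSimplex.ext hval
  have hc : c.pullback θ = c'.pullback θ := by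
    refine Subtype.ext (funext fun j => h _ ?_)
    have hj := Finset.orderEmbOfFin_mem S hk j
    exact (Finset.mem_filter.1 hj).2
  rw [← ht, ← point_pullback, ← point_pullback, hc]

/-! ### Subdivision of the simplex -/

/-- The time `s` lies in the `i`-th of the consecutive intervals of lengths `t₀, …, tₘ`. -/
def InSlot {m : ℕ} (t : Fin (m + 1) → ℝ) (s : ℝ) (i : Fin (m + 1)) : Prop :=
  ∑ l with l < i, t l ≤ s ∧ s ≤ ∑ l with l < i, t l + t i

/-- The length of the part before time `s` of the `j`-th of the consecutive intervals of lengths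
`t₀, …, tₘ`. -/
def lower {m : ℕ} (t : Fin (m + 1) → ℝ) (s : ℝ) (j : Fin (m + 1)) : ℝ :=
  max 0 (min (t j) (s - ∑ l with l < j, t l))

section

variable {m : ℕ} {t : Fin (m + 1) → ℝ} {s : ℝ}

theorem sum_lt_add_le (ht : ∀ l, 0 ≤ t l) {i j : Fin (m + 1)} (h : j < i) :
    ∑ l with l < j, t l + t j ≤ ∑ l with l < i, t l := by
  rw [add_comm, ← Finset.sum_insert (by simp)]
  refine Finset.sum_le_sum_of_subset_of_nonneg ?_ fun l _ _ => ht l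
  intro l hl
  simp only [Finset.mem_insert, Finset.mem_filter, Finset.mem_univ, true_and] at hl ⊢
  rcases hl with rfl | hl
  · exact h
  · exact hl.trans h

theorem exists_inSlot (ht : t ∈ stdSimplex ℝ (Fin (m + 1))) (h0 : 0 ≤ s) (h1 : s ≤ 1) :
    ∃ i, InSlot t s i := by
  classical
  have hne : (Finset.univ.filter fun i : Fin (m + 1) => ∑ l with l < i, t l ≤ s).Nonempty := by
    refine ⟨0, ?_⟩
    simpa using h0
  -- The last slot starting no later than `s` works: if it ended before `s`, either the next slot
  -- would also start by then, or the total length 1 would be less than `s`.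
  obtain ⟨i, hi, hmax⟩ := Finset.exists_max_image _ id hne
  refine ⟨i, (Finset.mem_filter.1 hi).2, ?_⟩
  have hins : ∑ l with l < i, t l + t i = ∑ l with l ≤ i, t l := by
    rw [add_comm, ← Finset.sum_insert (by simp)]
    congr 1
    ext l
    simp [le_iff_eq_or_lt]
  rw [hins]
  by_contra hlt
  push Not at hlt
  rcases Fin.eq_castSucc_or_eq_last i with ⟨j, hj⟩ | hj
  · have hmem : j.succ ∈ Finset.univ.filter fun i : Fin (m + 1) => ∑ l with l < i, t l ≤ s := by
      simp only [Finset.mem_filter, Finset.mem_univ, true_and]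
      refine le_trans (le_of_eq ?_) hlt.le
      congr 1
      ext l
      simp [hj, Fin.le_castSucc_iff]
    have := hmax _ hmem
    simp [hj, Fin.le_iff_val_le_val] at this
  · have : ∑ l with l ≤ i, t l = 1 := by
      rw [← ht.2]
      congr 1
      ext l
      simp [hj, Fin.le_last]
    linarith

theorem lower_nonneg (j : Fin (m + 1)) : 0 ≤ lower t s j := le_max_left _ _

theorem lower_le (ht : ∀ l, 0 ≤ t l) (j : Fin (m + 1)) : lower t s j ≤ t j :=
  max_le (ht j) (min_le_left _ _)

theorem lower_of_lt (ht : ∀ l, 0 ≤ t l) {i j : Fin (m + 1)} (hi : InSlot t s i) (h : j < i) :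
    lower t s j = t j := by
  have h1 := sum_lt_add_le ht h
  have h2 := hi.1
  rw [lower, min_eq_left (by linarith), max_eq_right (ht j)]

theorem lower_of_gt (ht : ∀ l, 0 ≤ t l) {i j : Fin (m + 1)} (hi : InSlot t s i) (h : i < j) :
    lower t s j = 0 := by
  have h1 := sum_lt_add_le ht h
  have h2 := hi.2
  exact max_eq_left ((min_le_right _ _).trans (by linarith))

theorem lower_self {i : Fin (m + 1)} (hi : InSlot t s i) :
    lower t s i = s - ∑ l with l < i, t l := by
  have h1 := hi.1
  have h2 := hi.2
  rw [lower, min_eq_right (by linarith), max_eq_right (by linarith)]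

theorem sum_fiber_lt {k : ℕ} (θ : Fin (m + 1) →o Fin (k + 1)) (L : Fin (k + 1)) :
    ∑ l with l < L, FunOnFinite.linearMap ℝ ℝ θ t l = ∑ j with θ j < L, t j := by
  simp only [FunOnFinite.linearMap_apply_apply]
  rw [Finset.sum_sigma', Finset.sum_filter, ← Finset.sum_filter]
  refine Finset.sum_bij (fun x _ => x.2) ?_ ?_ ?_ ?_
  · rintro ⟨l, j⟩ h
    simp only [Finset.mem_sigma, Finset.mem_filter, Finset.mem_univ, true_and] at h ⊢
    rw [h.2]; exact h.1
  · rintro ⟨l, j⟩ h ⟨l', j'⟩ h' hjj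
    simp only [Finset.mem_sigma, Finset.mem_filter, Finset.mem_univ, true_and] at h h' hjj
    subst hjj
    rw [← h.2, ← h'.2]
  · intro j hj
    exact ⟨⟨θ j, j⟩, by simpa using hj, rfl⟩
  · intros; rfl

theorem sum_lt_eq_add {k : ℕ} (θ : Fin (m + 1) →o Fin (k + 1)) (i : Fin (m + 1)) :
    ∑ l with l < i, t l = ∑ j with θ j < θ i, t j + ∑ j with θ j = θ i ∧ j < i, t j := by
  rw [← Finset.sum_union]
  · congr 1
    ext j
    simp only [Finset.mem_filter, Finset.mem_univ, true_and, Finset.mem_union]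
    constructor
    · intro h
      rcases (θ.monotone h.le).lt_or_eq with h1 | h1
      · exact Or.inl h1
      · exact Or.inr ⟨h1, h⟩
    · rintro (h | h)
      · exact θ.monotone.reflect_lt h
      · exact h.2
  · rw [Finset.disjoint_filter]
    rintro j - h1 h2
    exact h1.ne h2.1

/-- As `θ` is monotone, each slot of the pushed-forward weights is a concatenation of consecutive
slots of `t`. -/
theorem InSlot.map (ht : ∀ l, 0 ≤ t l) {k : ℕ} (θ : Fin (m + 1) →o Fin (k + 1)) {i : Fin (m + 1)}
    (hi : InSlot t s i) : InSlot (FunOnFinite.linearMap ℝ ℝ θ t) s (θ i) := by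
  have h1 := hi.1
  have h2 := hi.2
  have h4 : ∑ j with θ j = θ i ∧ j < i, t j + t i ≤ ∑ j with θ j = θ i, t j := by
    rw [add_comm, ← Finset.sum_insert (by simp)]
    refine Finset.sum_le_sum_of_subset_of_nonneg ?_ fun l _ _ => ht l
    intro l hl
    simp only [Finset.mem_insert, Finset.mem_filter, Finset.mem_univ, true_and] at hl ⊢
    rcases hl with rfl | hl
    · rfl
    · exact hl.1
  have h5 : 0 ≤ ∑ j with θ j = θ i ∧ j < i, t j := Finset.sum_nonneg fun l _ => ht l
  rw [sum_lt_eq_add θ i] at h1 h2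
  rw [InSlot, sum_fiber_lt, FunOnFinite.linearMap_apply_apply]
  constructor <;> linarith

/-- Cutting the unit interval at time `s` commutes with merging consecutive slots; only the slot
containing `s` needs a computation. -/
theorem linearMap_lower (ht : ∀ l, 0 ≤ t l) {k : ℕ} (θ : Fin (m + 1) →o Fin (k + 1))
    {i : Fin (m + 1)} (hi : InSlot t s i) :
    FunOnFinite.linearMap ℝ ℝ θ (lower t s) = lower (FunOnFinite.linearMap ℝ ℝ θ t) s := by
  have hθi := hi.map ht θ
  have ht' : ∀ l, 0 ≤ FunOnFinite.linearMap ℝ ℝ θ t l := fun l => by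
    rw [FunOnFinite.linearMap_apply_apply]; exact Finset.sum_nonneg fun j _ => ht j
  ext l
  rcases lt_trichotomy l (θ i) with h | rfl | h
  · rw [lower_of_lt ht' hθi h, FunOnFinite.linearMap_apply_apply,
      FunOnFinite.linearMap_apply_apply]
    refine Finset.sum_congr rfl fun j hj => lower_of_lt ht hi ?_
    rw [← (Finset.mem_filter.1 hj).2] at h
    exact θ.monotone.reflect_lt h
  · rw [lower_self hθi, sum_fiber_lt, FunOnFinite.linearMap_apply_apply]
    have hsplit : ∑ j with θ j = θ i, lower t s j
        = ∑ j with θ j = θ i ∧ j < i, t j + lower t s i := by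
      have hsub : insert i (Finset.univ.filter fun j => θ j = θ i ∧ j < i) ⊆
          Finset.univ.filter fun j => θ j = θ i := by
        intro l hl
        simp only [Finset.mem_insert, Finset.mem_filter, Finset.mem_univ, true_and] at hl ⊢
        rcases hl with rfl | hl
        · rfl
        · exact hl.1
      rw [← Finset.sum_subset hsub, Finset.sum_insert (by simp), add_comm]
      · congr 1
        exact Finset.sum_congr rfl fun j hj => lower_of_lt ht hi (Finset.mem_filter.1 hj).2.2
      · intro j hj hj'
        refine lower_of_gt ht hi ?_
        simp only [Finset.mem_insert, Finset.mem_filter, Finset.mem_univ, true_and, not_or,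
          not_and, not_lt] at hj hj'
        exact lt_of_le_of_ne (hj'.2 hj) (Ne.symm hj'.1)
    rw [hsplit, lower_self hi, sum_lt_eq_add θ i]
    ring
  · rw [lower_of_gt ht' hθi h, FunOnFinite.linearMap_apply_apply]
    refine Finset.sum_eq_zero fun j hj => lower_of_gt ht hi ?_
    rw [← (Finset.mem_filter.1 hj).2] at h
    exact θ.monotone.reflect_lt h

end

/-- The barycentric coordinates of the subdivision of the intervals of lengths `t₀, …, tₘ` at time
`s`. -/
def subdivide {m : ℕ} (t : stdSimplex ℝ (Fin (m + 1))) (s : ℝ) :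
    stdSimplex ℝ (Fin (m + 1 + 1)) :=
  ⟨FunOnFinite.linearMap ℝ ℝ Fin.castSucc (lower t s) +
      FunOnFinite.linearMap ℝ ℝ Fin.succ ((t : Fin (m + 1) → ℝ) - lower t s), by
    constructor
    · intro l
      rw [Pi.add_apply, FunOnFinite.linearMap_apply_apply, FunOnFinite.linearMap_apply_apply]
      exact add_nonneg (Finset.sum_nonneg fun j _ => lower_nonneg j)
        (Finset.sum_nonneg fun j _ => sub_nonneg.2 (lower_le (stdSimplex.zero_le t) j))
    · simp only [Pi.add_apply, Finset.sum_add_distrib]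
      rw [FunOnFinite.sum_linearMap, FunOnFinite.sum_linearMap]
      simp⟩

theorem subdivide_coe {m : ℕ} (t : stdSimplex ℝ (Fin (m + 1))) (s : ℝ) :
    (subdivide t s : Fin (m + 1 + 1) → ℝ) = FunOnFinite.linearMap ℝ ℝ Fin.castSucc (lower t s) +
      FunOnFinite.linearMap ℝ ℝ Fin.succ ((t : Fin (m + 1) → ℝ) - lower t s) := rfl

theorem continuous_subdivide {A : Type} [TopologicalSpace A] {m : ℕ}
    {t : A → stdSimplex ℝ (Fin (m + 1))} {s : A → ℝ} (ht : Continuous t) (hs : Continuous s) :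
    Continuous fun a => subdivide (t a) (s a) := by
  have hcoe : ∀ j, Continuous fun a => t a j := fun j =>
    (continuous_apply j).comp (continuous_subtype_val.comp ht)
  have hl : Continuous fun a => lower (t a) (s a) := by
    refine continuous_pi fun j => ?_
    unfold lower
    fun_prop
  refine Continuous.subtype_mk (Continuous.add ?_ ?_) _
  · exact (FunOnFinite.continuous_linearMap ℝ ℝ _).comp hl
  · exact (FunOnFinite.continuous_linearMap ℝ ℝ _).comp ((continuous_pi hcoe).sub hl)

theorem continuous_point {A : Type} [TopologicalSpace A] [TopologicalSpace X] {m : ℕ}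
    {c : A → NerveSimplex X m} {t : A → stdSimplex ℝ (Fin (m + 1))} (hc : Continuous c)
    (ht : Continuous t) : Continuous fun a => point (c a) (t a) :=
  continuous_quot_mk.comp (continuous_sigmaMk.comp (hc.prodMk ht))

/-- Slots are closed and share endpoints. If `s` lies in two of them, nothing has length strictly
between, so the vertices where the two prism chains differ carry no weight. -/
theorem subdivide_eq_zero {m : ℕ} {t : stdSimplex ℝ (Fin (m + 1))} {s : ℝ} {i i' : Fin (m + 1)}
    (hi : InSlot t s i) (hi' : InSlot t s i') {l : Fin (m + 1 + 1)} (h : i.castSucc < l)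
    (h' : l ≤ i'.castSucc) : subdivide t s l = 0 := by
  have ht := stdSimplex.zero_le t
  rw [subdivide_coe, Pi.add_apply, FunOnFinite.linearMap_apply_apply,
    FunOnFinite.linearMap_apply_apply, Finset.sum_eq_zero, Finset.sum_eq_zero, add_zero]
  · intro j hj
    rw [← (Finset.mem_filter.1 hj).2] at h'
    rw [Pi.sub_apply, lower_of_lt ht hi' (by simpa using h'), sub_self]
  · intro j hj
    rw [← (Finset.mem_filter.1 hj).2] at h
    exact lower_of_gt ht hi (by simpa using h)

/-! ### Prism operators and compatibility with gluing -/

/-- The operator `[k + 1] → [m + 1]` that doubles the vertex `i` of the source and the vertex `θ i`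
of the target. -/
def prismOp {k m : ℕ} (θ : Fin (k + 1) →o Fin (m + 1)) (i : Fin (k + 1)) :
    Fin (k + 1 + 1) →o Fin (m + 1 + 1) :=
  ⟨prismFun Fin.castSucc Fin.succ i θ, prismFun_monotone (Fin.strictMono_castSucc).monotone
    (Fin.strictMono_succ).monotone (fun _ => Fin.castSucc_lt_succ.le) i θ.monotone⟩

theorem prismFun_comp_prismOp {A B : Type} (f g : A → B) {k m : ℕ} (θ : Fin (k + 1) →o Fin (m + 1))
    (i : Fin (k + 1)) (c : Fin (m + 1) → A) :
    prismFun f g (θ i) c ∘ prismOp θ i = prismFun f g i (c ∘ θ) := by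
  funext l
  change prismFun f g (θ i) c (prismFun Fin.castSucc Fin.succ i θ l) = _
  by_cases h : l ≤ i.castSucc
  · have h1 : i.predAbove l ≤ i := by
      rw [Fin.predAbove_of_le_castSucc _ _ h, Fin.castPred_le_iff]; exact h
    have h2 := θ.monotone h1
    simp only [prismFun, h, if_true, Function.comp, Fin.castSucc_le_castSucc_iff, h2]
    rw [Fin.predAbove_castSucc_of_le _ _ h2]
  · have h0 := not_le.1 h
    have h1 : i ≤ i.predAbove l := by
      rw [Fin.predAbove_of_castSucc_lt _ _ h0, Fin.le_pred_iff]; exact Fin.castSucc_lt_iff_succ_le.1 h0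
    have h2 := θ.monotone h1
    have h3 : ¬ (θ (i.predAbove l)).succ ≤ (θ i).castSucc := by
      rw [not_le, Fin.castSucc_lt_succ_iff]; exact h2
    simp only [prismFun, h, if_false, Function.comp, h3]
    rw [Fin.predAbove_succ_of_le _ _ h2]

/-- The operator `prismOp θ i` agrees with `θ` on the lower copy only for vertices up to `i`, and on
the upper copy only from `i` on. This suffices, since the weights before and after time `s` are
supported there. -/
theorem map_prismOp_subdivide {k m : ℕ} (θ : Fin (k + 1) →o Fin (m + 1))
    (t : stdSimplex ℝ (Fin (k + 1))) {s : ℝ} {i : Fin (k + 1)} (hi : InSlot t s i) :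
    stdSimplex.map (prismOp θ i) (subdivide t s) = subdivide (stdSimplex.map θ t) s := by
  have ht := stdSimplex.zero_le t
  apply stdSimplex.ext
  rw [stdSimplex.map_coe, subdivide_coe, subdivide_coe, stdSimplex.map_coe,
    ← linearMap_lower ht θ hi, ← map_sub, map_add]
  simp only [← LinearMap.comp_apply, ← FunOnFinite.linearMap_comp]
  congr 1
  · refine FunOnFinite.linearMap_congr fun j hj => ?_
    have hji : j ≤ i := not_lt.1 fun h => hj (lower_of_gt ht hi h)
    change prismFun Fin.castSucc Fin.succ i θ j.castSucc = _
    simp [prismFun, hji, Fin.predAbove_castSucc_of_le _ _ hji]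
  · refine FunOnFinite.linearMap_congr fun j hj => ?_
    have hji : i ≤ j := not_lt.1 fun h => hj (by
      rw [Pi.sub_apply, lower_of_lt ht hi h, sub_self])
    have h3 : ¬ j.succ ≤ i.castSucc := by
      rw [not_le, Fin.castSucc_lt_succ_iff]; exact hji
    change prismFun Fin.castSucc Fin.succ i θ j.succ = _
    simp [prismFun, h3, Fin.predAbove_succ_of_le _ _ hji]

theorem exists_point (x : NerveRealization X) :
    ∃ (m : ℕ) (c : NerveSimplex X m) (t : stdSimplex ℝ (Fin (m + 1))), x = point c t := by
  induction x using Quot.ind with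
  | mk x => exact ⟨x.1, x.2.1, x.2.2, rfl⟩

/-! ### The maps and homotopies -/

section Prism

variable {f g : X → Y} (hf : Monotone f) (hg : Monotone g) (hfg : ∀ x, f x ≤ g x)

/-- The simplex `f c₀ ≤ ⋯ ≤ f cᵢ ≤ g cᵢ ≤ ⋯ ≤ g cₘ` of the nerve. -/
def prism {m : ℕ} (c : NerveSimplex X m) (i : Fin (m + 1)) : NerveSimplex Y (m + 1) :=
  ⟨prismFun f g i c.1, prismFun_monotone hf hg hfg i c.2⟩

/-- Independence of the chosen slot is what makes the homotopy well defined at the common endpoints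
of slots. -/
theorem point_prism_eq {m : ℕ} (c : NerveSimplex X m) {t : stdSimplex ℝ (Fin (m + 1))} {s : ℝ}
    {i i' : Fin (m + 1)} (hi : InSlot t s i) (hi' : InSlot t s i') :
    point (prism hf hg hfg c i) (subdivide t s) = point (prism hf hg hfg c i') (subdivide t s) := by
  wlog h : i ≤ i' generalizing i i'
  · exact (this hi' hi (le_of_not_ge h)).symm
  refine point_congr fun l hl => ?_
  change prismFun f g i c.1 l = prismFun f g i' c.1 l
  by_cases h1 : l ≤ i.castSucc
  · have h2 : l ≤ i'.castSucc := h1.trans (by simpa using h)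
    simp only [prismFun, h1, h2, if_true, Fin.predAbove_of_le_castSucc]
  · have h2 : ¬ l ≤ i'.castSucc := fun h2 => hl (subdivide_eq_zero hi hi' (not_le.1 h1) h2)
    simp only [prismFun, h1, h2, if_false]
    rw [Fin.predAbove_of_castSucc_lt _ _ (not_le.1 h1),
      Fin.predAbove_of_castSucc_lt _ _ (not_le.1 h2)]

/-- The prism homotopy before passing to the quotient. -/
def preHomotopy (x : PreRealization X) (s : I) : NerveRealization Y :=
  point (prism hf hg hfg x.2.1 (exists_inSlot x.2.2.2 s.2.1 s.2.2).choose) (subdivide x.2.2 s)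

theorem preHomotopy_eq {m : ℕ} (c : NerveSimplex X m) {t : stdSimplex ℝ (Fin (m + 1))} {s : I}
    {i : Fin (m + 1)} (hi : InSlot t s i) :
    preHomotopy hf hg hfg ⟨m, c, t⟩ s = point (prism hf hg hfg c i) (subdivide t s) :=
  point_prism_eq hf hg hfg c (exists_inSlot t.2 s.2.1 s.2.2).choose_spec hi

theorem preHomotopy_glue (s : I) {x y : PreRealization X} (h : RealizationRel X x y) :
    preHomotopy hf hg hfg x s = preHomotopy hf hg hfg y s := by
  obtain ⟨θ, c, t⟩ := h
  obtain ⟨i, hi⟩ := exists_inSlot t.2 s.2.1 s.2.2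
  have hi' : InSlot (stdSimplex.map θ t) s (θ i) := hi.map (stdSimplex.zero_le t) θ
  rw [preHomotopy_eq hf hg hfg _ hi, preHomotopy_eq hf hg hfg _ hi',
    ← map_prismOp_subdivide θ t hi, ← point_pullback]
  congr 1
  exact Subtype.ext (prismFun_comp_prismOp f g θ i c.1).symm

variable [TopologicalSpace X] [TopologicalSpace Y]

theorem isClosed_inSlot {m : ℕ} (i : Fin (m + 1)) :
    IsClosed {x : stdSimplex ℝ (Fin (m + 1)) × I | InSlot x.1 x.2 i} := by
  have hcoe : ∀ j, Continuous fun x : stdSimplex ℝ (Fin (m + 1)) × I => x.1 j := fun j =>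
    (continuous_apply j).comp (continuous_subtype_val.comp continuous_fst)
  have hsum : Continuous fun x : stdSimplex ℝ (Fin (m + 1)) × I => ∑ l with l < i, x.1 l :=
    continuous_finsetSum _ fun j _ => hcoe j
  have hs : Continuous fun x : stdSimplex ℝ (Fin (m + 1)) × I => (x.2 : ℝ) :=
    continuous_subtype_val.comp continuous_snd
  exact (isClosed_le hsum hs).inter (isClosed_le hs (hsum.add (hcoe i)))

/-- For fixed `m` the conditions `InSlot` give a finite closed cover, and on each piece the homotopy
is a continuous formula with constant slot `i`. -/
theorem continuous_preHomotopy (hcf : Continuous f) (hcg : Continuous g) :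
    Continuous fun x : PreRealization X × I => preHomotopy hf hg hfg x.1 x.2 := by
  rw [(Homeomorph.sigmaProdDistrib (Y := I)
    (X := fun m => NerveSimplex X m × stdSimplex ℝ (Fin (m + 1)))).symm.isQuotientMap.continuous_iff]
  refine continuous_sigma fun m => ?_
  let C : Fin (m + 1) → Set ((NerveSimplex X m × stdSimplex ℝ (Fin (m + 1))) × I) :=
    fun i => {x | InSlot x.1.2 x.2 i}
  have hsnd : Continuous fun x : (NerveSimplex X m × stdSimplex ℝ (Fin (m + 1))) × I =>
      (x.1.2, x.2) := (continuous_snd.comp continuous_fst).prodMk continuous_snd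
  refine (locallyFinite_of_finite C).continuous ?_ ?_ ?_
  · refine Set.eq_univ_of_forall fun x => Set.mem_iUnion.2 ?_
    exact exists_inSlot x.1.2.2 x.2.2.1 x.2.2.2
  · intro i
    exact (isClosed_inSlot i).preimage hsnd
  · intro i
    have hc : Continuous fun x : NerveSimplex X m => prism hf hg hfg x i := by
      refine Continuous.subtype_mk (continuous_pi fun l => ?_) _
      have hl : Continuous fun x : NerveSimplex X m => x.1 (i.predAbove l) :=
        (continuous_apply _).comp continuous_subtype_val
      by_cases h : l ≤ i.castSucc
      · simp only [prismFun, h, if_true]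
        exact hcf.comp hl
      · simp only [prismFun, h, if_false]
        exact hcg.comp hl
    have hs : Continuous fun x : (NerveSimplex X m × stdSimplex ℝ (Fin (m + 1))) × I =>
        (x.2 : ℝ) := continuous_subtype_val.comp continuous_snd
    have hK := continuous_point (hc.comp (continuous_fst.comp continuous_fst))
      (continuous_subdivide (continuous_snd.comp continuous_fst) hs)
    refine hK.continuousOn.congr fun x hx => ?_
    exact preHomotopy_eq hf hg hfg x.1.1 hx

end Prism

variable [TopologicalSpace X] [TopologicalSpace Y]

/-- The map of realizations induced by a continuous monotone map. -/
def map {f : X → Y} (hf : Monotone f) (hc : Continuous f) :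
    C(NerveRealization X, NerveRealization Y) where
  toFun := Quot.lift (fun x => point (x.2.1.map hf) x.2.2) (by
    rintro _ _ ⟨θ, c, t⟩
    exact point_pullback θ (c.map hf) t)
  continuous_toFun := by
    refine continuous_quot_lift _ ?_
    refine continuous_sigma fun m => ?_
    have h : Continuous fun x : NerveSimplex X m × stdSimplex ℝ (Fin (m + 1)) =>
        (x.1.map hf, x.2) := by
      refine Continuous.prodMk ?_ continuous_snd
      refine Continuous.subtype_mk (continuous_pi fun l => hc.comp ?_) _
      exact (continuous_apply l).comp (continuous_subtype_val.comp continuous_fst)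
    exact continuous_quot_mk.comp (continuous_sigmaMk.comp h)

/-- Comparable continuous monotone maps induce homotopic maps of realizations. -/
theorem homotopic_of_le {f g : X → Y} (hf : Monotone f) (hg : Monotone g) (hcf : Continuous f)
    (hcg : Continuous g) (hfg : ∀ x, f x ≤ g x) : (map hf hcf).Homotopic (map hg hcg) := by
  -- Reversed, because at time 0 all weight sits on the `g`-vertices and at time 1 on the
  -- `f`-vertices.
  refine ContinuousMap.Homotopic.symm ⟨⟨⟨fun x => Quot.lift (fun y => preHomotopy hf hg hfg y x.1)
    (fun _ _ h => preHomotopy_glue hf hg hfg x.1 h) x.2, ?_⟩, ?_, ?_⟩⟩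
  -- The unit interval is locally compact, so continuity on the product can be checked before
  -- passing to the quotient.
  · refine (isQuotientMap_quot_mk (r := RealizationRel X)).continuous_lift_prod_right ?_
    exact (continuous_preHomotopy hf hg hfg hcf hcg).comp continuous_swap
  · intro x
    obtain ⟨m, c, t, rfl⟩ := exists_point x
    have ht := stdSimplex.zero_le t
    have hlow : lower t 0 = 0 := by
      funext j
      refine max_eq_left ((min_le_right _ _).trans ?_)
      have := Finset.sum_nonneg fun l (_ : l ∈ Finset.univ.filter (· < j)) => ht l
      linarith
    have hi : InSlot t (0 : I) 0 := by simp [InSlot]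
    have hsub : subdivide t 0 = stdSimplex.map (Fin.succOrderEmb (m + 1)).toOrderHom t := by
      apply stdSimplex.ext
      rw [subdivide_coe, hlow, sub_zero, map_zero, zero_add]
      rfl
    change preHomotopy hf hg hfg ⟨m, c, t⟩ 0 = point (c.map hg) t
    rw [preHomotopy_eq hf hg hfg c hi, Set.Icc.coe_zero, hsub, ← point_pullback]
    congr 1
  · intro x
    obtain ⟨m, c, t, rfl⟩ := exists_point x
    have ht := stdSimplex.zero_le t
    have hsum : ∑ l with l < Fin.last m, t l + t (Fin.last m) = 1 := by
      rw [add_comm, ← Finset.sum_insert (by simp), ← stdSimplex.sum_eq_one t]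
      congr 1
      ext l
      simpa [le_iff_eq_or_lt] using Fin.le_last l
    have hi : InSlot t (1 : I) (Fin.last m) := by
      have := ht (Fin.last m)
      refine ⟨?_, hsum.ge⟩
      rw [Set.Icc.coe_one]; linarith
    have hlow : lower t 1 = t := by
      funext j
      rcases (Fin.le_last j).lt_or_eq with h | rfl
      · exact lower_of_lt ht hi h
      · rw [show (1 : ℝ) = ((1 : I) : ℝ) from rfl, lower_self hi, Set.Icc.coe_one]; linarith
    have hsub : subdivide t 1 = stdSimplex.map (Fin.castSuccOrderEmb (n := m + 1)).toOrderHom t := by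
      apply stdSimplex.ext
      rw [subdivide_coe, hlow, sub_self, map_zero, add_zero]
      rfl
    change preHomotopy hf hg hfg ⟨m, c, t⟩ 1 = point (c.map hf) t
    rw [preHomotopy_eq hf hg hfg c hi, Set.Icc.coe_one, hsub, ← point_pullback]
    congr 1
    refine Subtype.ext (funext fun l => ?_)
    change prismFun f g (Fin.last m) c.1 l.castSucc = f (c.1 l)
    simp [prismFun, Fin.le_last, Fin.predAbove_castSucc_of_le _ _ (Fin.le_last l)]

/-- A realization is contractible if the identity is linked to a constant map by a zigzag of
comparisons `x ≤ φ x ≥ ψ x ≤ b`. -/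
theorem contractibleSpace_of_zigzag {φ ψ : X → X} (b : X) (hφ : Monotone φ) (hψ : Monotone ψ)
    (hcφ : Continuous φ) (hcψ : Continuous ψ) (h1 : ∀ x, x ≤ φ x) (h2 : ∀ x, ψ x ≤ φ x)
    (h3 : ∀ x, ψ x ≤ b) : ContractibleSpace (NerveRealization X) := by
  have hid : map (monotone_id (α := X)) continuous_id = ContinuousMap.id _ := by
    ext x
    obtain ⟨m, c, t, rfl⟩ := exists_point x
    rfl
  have hb : Monotone fun _ : X => b := monotone_const
  rw [contractible_iff_id_nullhomotopic]
  let b₀ : NerveRealization X :=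
    point ⟨fun _ : Fin 1 => b, monotone_const⟩ (stdSimplex.vertex 0)
  refine ⟨b₀, ?_⟩
  have hconst : map hb continuous_const = ContinuousMap.const _ b₀ := by
    ext x
    obtain ⟨m, c, t, rfl⟩ := exists_point x
    -- A constant chain is degenerate: it is pulled back from the vertex `b`, and the 0-simplex is a
    -- single point.
    let θ : Fin (m + 1) →o Fin 1 := ⟨fun _ => 0, monotone_const⟩
    let c₀ : NerveSimplex X 0 := ⟨fun _ : Fin 1 => b, monotone_const⟩
    change point (c₀.pullback θ) t = point c₀ _
    rw [point_pullback]
    congr 1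
    exact Subsingleton.elim _ _
  rw [← hid, ← hconst]
  exact ((homotopic_of_le monotone_id hφ continuous_id hcφ h1).trans
    (homotopic_of_le hψ hφ hcψ hcφ h2).symm).trans
    (homotopic_of_le hψ hb hcψ continuous_const h3)

end NerveRealization

/-! ### Sets of subspaces and unordered decompositions -/

/-- A finite set of at least two nonzero mutually orthogonal subspaces that span `ℂⁿ`. -/
structure IsOrthogonalDecomposition {n : ℕ} (s : Set (Submodule ℂ (CSpace n))) : Prop where
  finite : s.Finite
  bot_notMem : ⊥ ∉ s
  pairwise : s.Pairwise (· ⟂ ·)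
  sSup_eq : sSup s = ⊤
  nontrivial : s.Nontrivial

theorem GrPos.space_ne_bot {n : ℕ} (V : GrPos n) : V.space ≠ ⊥ := by
  obtain ⟨⟨k, hk⟩, V, hV⟩ := V
  change V ≠ ⊥
  rintro rfl
  rw [finrank_bot] at hV
  exact absurd (hk.trans_eq hV.symm) (by norm_num)

theorem GrPos.space_injective {n : ℕ} : Function.Injective (GrPos.space (n := n)) := by
  rintro ⟨⟨k, hk⟩, V, hV⟩ ⟨⟨k', hk'⟩, V', hV'⟩ h
  obtain rfl : V = V' := h
  change Module.finrank ℂ V = k at hV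
  change Module.finrank ℂ V = k' at hV'
  subst hV
  subst hV'
  rfl

/-- A nonzero subspace as a point of the union of the Grassmannians. -/
def GrPos.ofSpace {n : ℕ} (V : Submodule ℂ (CSpace n)) (h : V ≠ ⊥) : GrPos n :=
  ⟨⟨Module.finrank ℂ V, Nat.one_le_iff_ne_zero.2 (mt Submodule.finrank_eq_zero.1 h)⟩, V, rfl⟩

theorem GrPos.continuous_starProjection {n : ℕ} :
    Continuous fun V : GrPos n => V.space.starProjection :=
  continuous_sigma fun _ => continuous_induced_dom

namespace UPartition

variable {n : ℕ}

/-- The unordered family underlying a tuple of nonzero subspaces. -/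
def family {m : ℕ} (hm : 1 < m) (v : Fin m → GrPos n) : SubspaceFamily n :=
  ⟨⟨m, hm⟩, Quotient.mk _ v⟩

/-- The unordered decomposition with given tuple of subspaces. -/
def ofTuple {m : ℕ} (hm : 1 < m) (v : Fin m → GrPos n)
    (ho : ∀ i j, i ≠ j → (v i).space ⟂ (v j).space) (ht : ⨆ i, (v i).space = ⊤) : UPartition n :=
  ⟨family hm v, v, rfl, ho, ht⟩

theorem exists_eq_ofTuple (l : UPartition n) : ∃ (m : ℕ) (hm : 1 < m) (v : Fin m → GrPos n)
    (ho : ∀ i j, i ≠ j → (v i).space ⟂ (v j).space) (ht : ⨆ i, (v i).space = ⊤),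
    l = ofTuple hm v ho ht := by
  obtain ⟨⟨⟨m, hm⟩, q⟩, v, hv, ho, ht⟩ := l
  exact ⟨m, hm, v, ho, ht, Subtype.ext (congrArg (Sigma.mk _) hv.symm)⟩

theorem space_injective_of_orthogonal {m : ℕ} {v : Fin m → GrPos n}
    (ho : ∀ i j, i ≠ j → (v i).space ⟂ (v j).space) :
    Function.Injective fun i => (v i).space := by
  intro i j hij
  by_contra hne
  have h := ho i j hne
  rw [show (v i).space = (v j).space from hij, Submodule.isOrtho_self] at h
  exact (v j).space_ne_bot h

theorem isOrthogonalDecomposition_classes (l : UPartition n) :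
    IsOrthogonalDecomposition l.classes := by
  obtain ⟨m, hm, v, ho, ht, rfl⟩ := exists_eq_ofTuple l
  refine ⟨Set.finite_range fun i => (v i).space, ?_, ?_, ht, ?_⟩
  · rintro ⟨i, hi⟩
    exact (v i).space_ne_bot hi
  · rintro _ ⟨i, rfl⟩ _ ⟨j, rfl⟩ hij
    exact ho i j fun h => hij (by rw [h])
  · refine ⟨_, ⟨⟨0, zero_lt_one.trans hm⟩, rfl⟩, _, ⟨⟨1, hm⟩, rfl⟩, fun h => ?_⟩
    exact zero_ne_one (congrArg Fin.val (space_injective_of_orthogonal ho h))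

/-- Orthogonal nonzero members are distinct, so no multiplicities are lost: two tuples with the same
set of members differ by a permutation. -/
theorem classes_injective : Function.Injective (classes (n := n)) := by
  intro l l' h
  obtain ⟨m, hm, v, ho, ht, rfl⟩ := exists_eq_ofTuple l
  obtain ⟨m', hm', v', ho', ht', rfl⟩ := exists_eq_ofTuple l'
  change Set.range (fun i => (v i).space) = Set.range fun i => (v' i).space at h
  have hi := space_injective_of_orthogonal ho
  have hi' := space_injective_of_orthogonal ho'
  let σ : Fin m' ≃ Fin m :=
    (Equiv.ofInjective _ hi').trans ((Equiv.setCongr h.symm).trans (Equiv.ofInjective _ hi).symm)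
  have hσ : ∀ i, v (σ i) = v' i := fun i => GrPos.space_injective (by
    have := Equiv.apply_ofInjective_symm hi ((Equiv.setCongr h.symm) (Equiv.ofInjective _ hi' i))
    exact this)
  obtain rfl : m' = m := by simpa using Fintype.card_congr σ
  have hq : family hm v = family hm v' := by
    unfold family
    congr 1
    exact Quotient.sound ⟨σ, funext fun i => (hσ i).symm⟩
  exact Subtype.ext hq

theorem exists_classes_eq {s : Set (Submodule ℂ (CSpace n))} (hs : IsOrthogonalDecomposition s) :
    ∃ l : UPartition n, l.classes = s := by
  have := hs.finite.to_subtype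
  have : Nontrivial s := Set.nontrivial_coe_sort.2 hs.nontrivial
  let e := (Finite.equivFin s).symm
  have hm : 1 < Nat.card s := Finite.one_lt_card
  let v : Fin (Nat.card s) → GrPos n := fun i =>
    GrPos.ofSpace (e i).1 fun h => hs.bot_notMem (h ▸ (e i).2)
  have hrange : Set.range (fun i => (v i).space) = s := by
    change Set.range (Subtype.val ∘ e) = s
    rw [e.surjective.range_comp, Subtype.range_coe]
  refine ⟨ofTuple hm v (fun i j hij => hs.pairwise (e i).2 (e j).2 fun h =>
    hij (e.injective (Subtype.ext h))) ?_, hrange⟩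
  rw [← sSup_range, hrange, hs.sSup_eq]

/-- The unordered decomposition with given set of subspaces. -/
def ofClasses (s : Set (Submodule ℂ (CSpace n))) (hs : IsOrthogonalDecomposition s) :
    UPartition n :=
  (exists_classes_eq hs).choose

theorem classes_ofClasses (s : Set (Submodule ℂ (CSpace n))) (hs : IsOrthogonalDecomposition s) :
    (ofClasses s hs).classes = s :=
  (exists_classes_eq hs).choose_spec

end UPartition

/-! ### Continuous families of subspaces -/

section Projections

variable {E : Type} [NormedAddCommGroup E] [InnerProductSpace ℂ E] [FiniteDimensional ℂ E]

/-- A nonzero vector of one subspace is fixed, up to sign, by the difference of projections. -/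
theorem Submodule.one_le_norm_starProjection_sub {U W : Submodule ℂ E} (h : U ⟂ W) (hne : U ≠ W) :
    1 ≤ ‖U.starProjection - W.starProjection‖ := by
  wlog hU : U ≠ ⊥ generalizing U W
  · rw [norm_sub_rev]
    refine this h.symm hne.symm fun hW => hne ?_
    rw [hW, not_not.1 hU]
  obtain ⟨x, hx, hx0⟩ := Submodule.exists_mem_ne_zero_of_ne_bot hU
  have h1 : (U.starProjection - W.starProjection) x = x := by
    have hW : W.starProjection x = 0 :=
      (W.starProjection_apply_eq_zero_iff).2 (h hx)
    rw [_root_.sub_apply, hW, sub_zero, Submodule.starProjection_eq_self_iff.2 hx]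
  have h2 := (U.starProjection - W.starProjection).le_opNorm x
  rw [h1] at h2
  exact (le_mul_iff_one_le_left (norm_pos_iff.2 hx0)).1 h2

variable {A : Type} [TopologicalSpace A] {a₀ : A}

/-- The norm of the difference of projections is either 0 or at least 1 and varies continuously, so
coincidence is locally constant. -/
theorem eventually_eq_iff_of_orthogonal {U W : A → Submodule ℂ E}
    (hU : ContinuousAt (fun a => (U a).starProjection) a₀)
    (hW : ContinuousAt (fun a => (W a).starProjection) a₀) (h : ∀ a, U a = W a ∨ U a ⟂ W a) :
    ∀ᶠ a in 𝓝 a₀, (U a = W a ↔ U a₀ = W a₀) := by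
  have hc : ContinuousAt (fun a => ‖(U a).starProjection - (W a).starProjection‖) a₀ :=
    (hU.sub hW).norm
  by_cases h0 : U a₀ = W a₀
  · have h1 : ‖(U a₀).starProjection - (W a₀).starProjection‖ < 1 := by simp [h0]
    filter_upwards [hc.eventually_lt_const h1] with a ha
    refine iff_of_true ?_ h0
    by_contra hne
    exact absurd ha (not_lt.2 (Submodule.one_le_norm_starProjection_sub
      ((h a).resolve_left hne) hne))
  · have h1 : 0 < ‖(U a₀).starProjection - (W a₀).starProjection‖ :=
      zero_lt_one.trans_le (Submodule.one_le_norm_starProjection_sub ((h a₀).resolve_left h0) h0)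
    filter_upwards [hc.eventually_const_lt h1] with a ha
    refine iff_of_false ?_ h0
    intro heq
    simp [heq] at ha

theorem Submodule.trace_starProjection (U : Submodule ℂ E) :
    LinearMap.trace ℂ E U.starProjection = (Module.finrank ℂ U : ℂ) := by
  refine LinearMap.IsProj.trace (p := U) ⟨fun x => ?_, fun x hx => ?_⟩
  · exact U.starProjection_apply_mem x
  · exact Submodule.starProjection_eq_self_iff.2 hx

/-- The dimension is the trace of the projection, a continuous function with integer values. -/
theorem eventually_finrank_eq {U : A → Submodule ℂ E}
    (hU : ContinuousAt (fun a => (U a).starProjection) a₀) :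
    ∀ᶠ a in 𝓝 a₀, Module.finrank ℂ (U a) = Module.finrank ℂ (U a₀) := by
  let τ : (E →L[ℂ] E) →ₗ[ℂ] ℂ := (LinearMap.trace ℂ E).comp (ContinuousLinearMap.coeLM ℂ)
  have hτ : Continuous τ := τ.continuous_of_finiteDimensional
  have hc : ContinuousAt (fun a => τ (U a).starProjection) a₀ := hτ.continuousAt.comp hU
  have hd := Metric.continuousAt_iff'.1 hc 1 one_pos
  filter_upwards [hd] with a ha
  change dist (LinearMap.trace ℂ E (U a).starProjection)
    (LinearMap.trace ℂ E (U a₀).starProjection) < 1 at ha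
  rw [Submodule.trace_starProjection, Submodule.trace_starProjection, dist_eq_norm] at ha
  have h2 : ‖(((Module.finrank ℂ (U a) : ℤ) - (Module.finrank ℂ (U a₀) : ℤ) : ℤ) : ℂ)‖ < 1 := by
    push_cast
    exact ha
  rw [Complex.norm_intCast] at h2
  have h3 : |(Module.finrank ℂ (U a) : ℤ) - (Module.finrank ℂ (U a₀) : ℤ)| < 1 := by
    exact_mod_cast h2
  rw [Int.abs_lt_one_iff] at h3
  omega

end Projections

/-! ### Continuity into and out of the space of unordered decompositions -/

namespace UPartition

variable {n : ℕ} {A : Type} [TopologicalSpace A]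

/-- A map to the space of unordered decompositions is continuous if the classes are the nonzero
members of a finite family of subspaces whose projections vary continuously. -/
theorem continuousAt_of_family {Φ : A → UPartition n} {ι : Type} [Finite ι]
    {V : A → ι → Submodule ℂ (CSpace n)} {a₀ : A}
    (hV : ∀ i, ContinuousAt (fun a => (V a i).starProjection) a₀)
    (hcl : ∀ a, (Φ a).classes = Set.range (V a) \ {⊥}) : ContinuousAt Φ a₀ := by
  obtain ⟨m, hm, v, ho, ht, hv⟩ := exists_eq_ofTuple (Φ a₀)
  have hcl₀ : Set.range (fun j => (v j).space) = Set.range (V a₀) \ {⊥} := by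
    rw [← hcl, hv]; rfl
  have he : ∀ j, ∃ i, V a₀ i = (v j).space := fun j =>
    (hcl₀ ▸ Set.mem_range_self j : (v j).space ∈ Set.range (V a₀) \ {⊥}).1
  -- One index is selected for each class at `a₀`. Vanishing and coincidences among the `V a i` are
  -- constant near `a₀`, so the same indices list each class of `Φ a` exactly once.
  choose e he using he
  have hmem : ∀ a i, V a i ≠ ⊥ → V a i ∈ (Φ a).classes := fun a i hi => by
    rw [hcl]; exact ⟨⟨i, rfl⟩, hi⟩
  have hdich : ∀ a i i', V a i = V a i' ∨ V a i ⟂ V a i' := by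
    intro a i i'
    by_cases h1 : V a i = ⊥
    · exact Or.inr (by simp [h1])
    by_cases h2 : V a i' = ⊥
    · exact Or.inr (by simp [h2])
    rw [or_iff_not_imp_left]
    exact fun h => (Φ a).isOrthogonalDecomposition_classes.pairwise (hmem a i h1) (hmem a i' h2) h
  have ev1 : ∀ᶠ a in 𝓝 a₀, ∀ i, (V a i = ⊥ ↔ V a₀ i = ⊥) :=
    Filter.eventually_all.2 fun i => eventually_eq_iff_of_orthogonal (W := fun _ => ⊥) (hV i)
      continuousAt_const fun a => Or.inr (by simp)
  have ev2 : ∀ᶠ a in 𝓝 a₀, ∀ i i', (V a i = V a i' ↔ V a₀ i = V a₀ i') :=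
    Filter.eventually_all.2 fun i => Filter.eventually_all.2 fun i' =>
      eventually_eq_iff_of_orthogonal (hV i) (hV i') fun a => hdich a i i'
  have ev3 : ∀ᶠ a in 𝓝 a₀, ∀ i, Module.finrank ℂ (V a i) = Module.finrank ℂ (V a₀ i) :=
    Filter.eventually_all.2 fun i => eventually_finrank_eq (hV i)
  classical
  have hk : ∀ j, 1 ≤ Module.finrank ℂ (V a₀ (e j)) := fun j => by
    rw [he, Nat.one_le_iff_ne_zero]
    exact mt Submodule.finrank_eq_zero.1 (v j).space_ne_bot
  -- The fallback value is irrelevant: dimensions are constant near `a₀`.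
  let W : A → (j : Fin m) → Gr n (Module.finrank ℂ (V a₀ (e j))) := fun a j =>
    if h : Module.finrank ℂ (V a (e j)) = Module.finrank ℂ (V a₀ (e j)) then ⟨V a (e j), h⟩
    else ⟨V a₀ (e j), rfl⟩
  have hW : ∀ j, ∀ᶠ a in 𝓝 a₀, (W a j).1 = V a (e j) := fun j => by
    filter_upwards [ev3] with a ha
    exact congrArg Subtype.val (dif_pos (ha (e j)))
  have hWc : ∀ j, ContinuousAt (fun a => W a j) a₀ := fun j => by
    rw [(Topology.IsInducing.induced
      (fun V : Gr n (Module.finrank ℂ (V a₀ (e j))) => V.1.starProjection)).continuousAt_iff]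
    refine (hV (e j)).congr ?_
    filter_upwards [hW j] with a ha
    simp only [Function.comp, ha]
  let w : A → Fin m → GrPos n := fun a j => ⟨⟨_, hk j⟩, W a j⟩
  have hwc : ContinuousAt w a₀ := continuousAt_pi.2 fun j =>
    (continuous_sigmaMk (σ := fun k : {k : ℕ // 1 ≤ k} => Gr n k.1)
      (i := ⟨_, hk j⟩)).continuousAt.comp (hWc j)
  have hfc : ContinuousAt (fun a => family hm (w a)) a₀ :=
    ((continuous_sigmaMk (σ := fun m : {m : ℕ // 1 < m} => UnorderedTuple (GrPos n) m.1)
      (i := ⟨m, hm⟩)).comp continuous_quotient_mk').continuousAt.comp hwc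
  refine (Topology.IsInducing.induced
    (Subtype.val : UPartition n → SubspaceFamily n)).continuousAt_iff.2 ?_
  refine hfc.congr ?_
  filter_upwards [ev1, ev2, Filter.eventually_all.2 hW] with a h1 h2 h3
  have hws : ∀ j, (w a j).space = V a (e j) := h3
  have hrange : Set.range (fun j => (w a j).space) = (Φ a).classes := by
    rw [hcl]
    ext U
    constructor
    · rintro ⟨j, rfl⟩
      refine ⟨⟨e j, (hws j).symm⟩, ?_⟩
      exact (w a j).space_ne_bot
    · rintro ⟨⟨i, rfl⟩, hi⟩
      have hi0 : V a₀ i ≠ ⊥ := fun h => hi ((h1 i).2 h)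
      obtain ⟨j, hj⟩ : V a₀ i ∈ Set.range fun j => (v j).space := by
        rw [hcl₀]; exact ⟨⟨i, rfl⟩, hi0⟩
      refine ⟨j, ?_⟩
      change (w a j).space = V a i
      rw [hws, h2, he]
      exact hj
  have hdec := (Φ a).isOrthogonalDecomposition_classes
  have ho' : ∀ i j, i ≠ j → (w a i).space ⟂ (w a j).space := by
    intro i j hij
    refine hdec.pairwise (hrange ▸ ⟨i, rfl⟩) (hrange ▸ ⟨j, rfl⟩) ?_
    rw [hws, hws, Ne, h2, he, he]
    exact fun h => hij (space_injective_of_orthogonal ho h)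
  have ht' : ⨆ i, (w a i).space = ⊤ := by
    rw [← sSup_range, hrange, hdec.sSup_eq]
  have : ofTuple hm (w a) ho' ht' = Φ a := classes_injective hrange
  exact congrArg Subtype.val this

/-- The ordered tuples that represent an unordered decomposition with a given property. -/
abbrev TupleOver (P : UPartition n → Prop) {m : ℕ} (hm : 1 < m) : Type :=
  {v : Fin m → GrPos n // ∃ h : (family hm v).IsDecomposition, P ⟨family hm v, h⟩}

/-- The unordered decomposition represented by a tuple. -/
def TupleOver.toPartition {P : UPartition n → Prop} {m : ℕ} {hm : 1 < m} (v : TupleOver P hm) :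
    {l : UPartition n // P l} :=
  ⟨⟨family hm v.1, v.2.choose⟩, v.2.choose_spec⟩

theorem TupleOver.classes_toPartition {P : UPartition n → Prop} {m : ℕ} {hm : 1 < m}
    (v : TupleOver P hm) : v.toPartition.1.classes = Set.range fun i => (v.1 i).space := rfl

/-- The saturation of an open set is the union of its translates under permutations. -/
theorem isOpenMap_quotient_mk (α : Type) [TopologicalSpace α] (m : ℕ) :
    IsOpenMap (Quotient.mk (permSetoid α m)) := by
  intro U hU
  rw [← isQuotientMap_quotient_mk'.isOpen_preimage]
  have : Quotient.mk (permSetoid α m) ⁻¹' (Quotient.mk (permSetoid α m) '' U) =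
      ⋃ σ : Equiv.Perm (Fin m), (fun v : Fin m → α => v ∘ σ) ⁻¹' U := by
    ext v
    simp only [Set.mem_preimage, Set.mem_image, Set.mem_iUnion]
    constructor
    · rintro ⟨u, hu, huv⟩
      obtain ⟨σ, hσ⟩ : permSetoid α m v u := Quotient.exact huv.symm
      exact ⟨σ, hσ ▸ hu⟩
    · rintro ⟨σ, hσ⟩
      have h : permSetoid α m v (v ∘ σ) := ⟨σ, rfl⟩
      exact ⟨_, hσ, (Quotient.sound h).symm⟩
  change IsOpen (Quotient.mk (permSetoid α m) ⁻¹' (Quotient.mk (permSetoid α m) '' U))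
  rw [this]
  exact isOpen_iUnion fun σ => hU.preimage
    (continuous_pi fun i => continuous_apply (σ i))

theorem TupleOver.isOpenMap_toPartition {P : UPartition n → Prop} {m : ℕ} (hm : 1 < m) :
    IsOpenMap (TupleOver.toPartition (P := P) (hm := hm)) := by
  rintro _ ⟨U, hU, rfl⟩
  have hopen : IsOpen (family hm '' U) := by
    have : family (n := n) hm = Sigma.mk (⟨m, hm⟩ : {m : ℕ // 1 < m}) ∘
        Quotient.mk (permSetoid (GrPos n) m) := rfl
    rw [this, Set.image_comp]
    exact isOpenMap_sigmaMk _ (isOpenMap_quotient_mk _ _ _ hU)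
  refine ⟨_, ⟨_, hopen, rfl⟩, ?_⟩
  ext l
  constructor
  · rintro ⟨v, hv, hvl⟩
    obtain ⟨⟨F, hF⟩, hP⟩ := l
    obtain rfl : family hm v = F := hvl
    exact ⟨⟨v, hF, hP⟩, hv, rfl⟩
  · rintro ⟨v, hv, rfl⟩
    exact ⟨v.1, hv, rfl⟩

theorem TupleOver.exists_toPartition_eq {P : UPartition n → Prop} (l : {l : UPartition n // P l}) :
    ∃ (m : ℕ) (hm : 1 < m) (v : TupleOver P hm), v.toPartition = l := by
  obtain ⟨l, hl⟩ := l
  obtain ⟨m, hm, v, ho, ht, rfl⟩ := exists_eq_ofTuple l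
  have hv : ∃ h : (family hm v).IsDecomposition, P ⟨family hm v, h⟩ := ⟨(ofTuple hm v ho ht).2, hl⟩
  exact ⟨m, hm, ⟨v, hv⟩, rfl⟩

/-- Continuity on a space of unordered decompositions can be tested on ordered tuples. -/
theorem continuous_of_tupleOver {P : UPartition n → Prop} {Z : Type} [TopologicalSpace Z]
    {Φ : {l : UPartition n // P l} → Z}
    (h : ∀ {m : ℕ} (hm : 1 < m) (v : TupleOver P hm),
      ContinuousAt (fun v : TupleOver P hm => Φ v.toPartition) v) : Continuous Φ := by
  rw [continuous_iff_continuousAt]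
  intro l
  obtain ⟨m, hm, v, rfl⟩ := TupleOver.exists_toPartition_eq l
  -- Openness of `toPartition` bounds the neighbourhoods of a decomposition by images of
  -- neighbourhoods of a representing tuple.
  exact (Filter.tendsto_map'_iff.2 (h hm v)).mono_left
    ((TupleOver.isOpenMap_toPartition hm).nhds_le v)

theorem TupleOver.continuous_starProjection {P : UPartition n → Prop} {m : ℕ} (hm : 1 < m)
    (i : Fin m) : Continuous fun v : TupleOver P hm => (v.1 i).space.starProjection :=
  GrPos.continuous_starProjection.comp ((continuous_apply i).comp continuous_subtype_val)

end UPartition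

/-! ### Central elements of the Frattini subgroup -/

/-- The subgroup generated by the commutators and the `p`-th powers. -/
def commutatorPow (p : ℕ) (Q : Type) [Group Q] : Subgroup Q :=
  Subgroup.closure ({x | ∃ a b : Q, ⁅a, b⁆ = x} ∪ {x | ∃ a : Q, a ^ p = x})

section Abstract

variable {p : ℕ} {Q : Type} [Group Q]

theorem commutatorElement_mem_commutatorPow (a b : Q) : ⁅a, b⁆ ∈ commutatorPow p Q :=
  Subgroup.subset_closure (Or.inl ⟨a, b, rfl⟩)

theorem pow_mem_commutatorPow (a : Q) : a ^ p ∈ commutatorPow p Q :=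
  Subgroup.subset_closure (Or.inr ⟨a, rfl⟩)

instance commutatorPow_normal : (commutatorPow p Q).Normal where
  conj_mem x hx g := by
    have h := mul_mem (commutatorElement_mem_commutatorPow (p := p) g x) hx
    rwa [commutatorElement_def, inv_mul_cancel_right] at h

/-- A nontrivial finite normal `p`-subgroup on which the conjugation action factors through a
`p`-group contains nontrivial central elements. -/
theorem exists_central_of_normal [Fact p.Prime] (A T : Subgroup Q) [A.Normal] [Finite A]
    (hA : IsPGroup p A) (hne : A ≠ ⊥) (hT : ∀ a ∈ A, ∀ t ∈ T, t * a = a * t)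
    (hpow : ∀ q : Q, ∃ k, q ^ p ^ k ∈ T) : ∃ z ∈ A, z ≠ 1 ∧ ∀ q, q * z = z * q := by
  -- Since `T` acts trivially, the image of conjugation is a `p`-group, and counting fixed points
  -- modulo `p` gives one besides 1.
  let φ : Q →* MulAut A := MulAut.conjNormal
  have hφ : IsPGroup p φ.range := by
    rintro ⟨_, q, rfl⟩
    obtain ⟨k, hk⟩ := hpow q
    refine ⟨k, Subtype.ext ?_⟩
    change φ q ^ p ^ k = 1
    rw [← map_pow]
    ext a
    rw [MulAut.conjNormal_apply, hT a a.2 _ hk, mul_inv_cancel_right]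
    rfl
  have hdvd : p ∣ Nat.card A := by
    refine hA.card_eq_or_dvd.resolve_left fun h => hne ?_
    exact Subgroup.card_eq_one.1 h
  have h1 : (1 : A) ∈ MulAction.fixedPoints φ.range A := fun g => map_one g.1
  obtain ⟨z, hz, hz1⟩ := hφ.exists_fixed_point_of_prime_dvd_card_of_fixed_point A hdvd h1
  refine ⟨z, z.2, fun h => hz1 (Subtype.ext h.symm), fun q => ?_⟩
  have h := congrArg Subtype.val (hz ⟨φ q, q, rfl⟩)
  change (φ q z : Q) = z at h
  rw [MulAut.conjNormal_apply] at h
  exact mul_inv_eq_iff_eq_mul.1 h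

/-- Stop one step before the iterated `p`-th powers first become trivial. -/
theorem exists_pow_of_pow_prime_pow {x : Q} (hx : x ≠ 1) {k : ℕ} (hk : x ^ p ^ k = 1) :
    ∃ j, x ^ p ^ j ≠ 1 ∧ (x ^ p ^ j) ^ p = 1 := by
  classical
  have hex : ∃ k, x ^ p ^ k = 1 := ⟨k, hk⟩
  obtain ⟨j, hj⟩ := Nat.exists_eq_succ_of_ne_zero (n := Nat.find hex) fun h0 => by
    have := Nat.find_spec hex
    rw [h0, pow_zero, pow_one] at this
    exact hx this
  refine ⟨j, Nat.find_min hex (by omega), ?_⟩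
  rw [← pow_mul, ← pow_succ, ← Nat.succ_eq_add_one, ← hj]
  exact Nat.find_spec hex

/-- If `T` is trivial, `Q` is a finite `p`-group and its nontrivial Frattini-type subgroup contains
central elements. Otherwise a central element of order `p` is found inside `T`, and divisibility
makes it a `p`-th power. -/
theorem exists_central_mem_commutatorPow [Fact p.Prime] (T : Subgroup Q) [T.Normal]
    (hcomm : ∀ x ∈ T, ∀ y ∈ T, x * y = y * x) [Finite (Q ⧸ T)] (hP : IsPGroup p (Q ⧸ T))
    (hdiv : ∀ x ∈ T, ∃ y, y ^ p = x) (htors : T ≠ ⊥ → ∃ x ∈ T, x ≠ 1 ∧ x ^ p = 1)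
    (hne : ¬ IsElementaryAbelian p Q) :
    ∃ z ∈ commutatorPow p Q, z ≠ 1 ∧ z ^ p = 1 ∧ ∀ q, q * z = z * q := by
  have hpow : ∀ q : Q, ∃ k, q ^ p ^ k ∈ T := fun q => by
    obtain ⟨k, hk⟩ := hP (q : Q ⧸ T)
    exact ⟨k, (QuotientGroup.eq_one_iff _).1 (by simpa using hk)⟩
  by_cases hT : T = ⊥
  · subst hT
    have hfin : Finite Q := Finite.of_equiv _ (QuotientGroup.quotientBot (G := Q)).toEquiv
    have hQ : IsPGroup p Q := hP.of_equiv QuotientGroup.quotientBot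
    have hΦ : commutatorPow p Q ≠ ⊥ := fun h => hne ⟨hfin, fun x y => by
        have h1 := commutatorElement_mem_commutatorPow (p := p) x y
        rw [h, Subgroup.mem_bot] at h1
        exact commutatorElement_eq_one_iff_mul_comm.1 h1, fun x => by
        have h1 := pow_mem_commutatorPow (p := p) x
        rwa [h, Subgroup.mem_bot] at h1⟩
    obtain ⟨z, hz, hz1, hzc⟩ := exists_central_of_normal (p := p) (commutatorPow p Q) ⊥
      (hQ.to_subgroup _) hΦ (by rintro a - t rfl; simp) hpow
    obtain ⟨k, hk⟩ := hQ z
    obtain ⟨j, hj, hj'⟩ := exists_pow_of_pow_prime_pow hz1 hk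
    refine ⟨z ^ p ^ j, pow_mem hz _, hj, hj', fun q => ?_⟩
    exact (Commute.pow_right (hzc q) _).eq
  · obtain ⟨x, hxT, hx1, hxp⟩ := htors hT
    let A : Subgroup Q := Subgroup.normalClosure {x}
    have hAT : A ≤ T := Subgroup.normalClosure_le_normal (by simpa using hxT)
    have hAcomm : ∀ a b : A, a * b = b * a := fun a b =>
      Subtype.ext (hcomm a (hAT a.2) b (hAT b.2))
    let _ : CommGroup A := { (inferInstance : Group A) with mul_comm := hAcomm }
    -- Conjugates of `x` depend only on the coset modulo the abelian group `T`, so there are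
    -- finitely many. They generate `A`, which is thus a finite group of exponent dividing `p`.
    have hfinconj : (Group.conjugatesOfSet ({x} : Set Q)).Finite := by
      have hsub : Group.conjugatesOfSet ({x} : Set Q) ⊆
          Set.range fun c : Q ⧸ T => c.out * x * c.out⁻¹ := by
        intro y hy
        obtain ⟨x', hx', hc⟩ := Group.mem_conjugatesOfSet_iff.1 hy
        obtain rfl : x' = x := hx'
        obtain ⟨q, rfl⟩ := isConj_iff.1 hc
        obtain ⟨t, ht⟩ := QuotientGroup.mk_out_eq_mul T q
        refine ⟨q, ?_⟩
        change (q : Q ⧸ T).out * x' * (q : Q ⧸ T).out⁻¹ = _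
        rw [ht, mul_assoc q, hcomm t t.2 x' hxT]
        group
      exact (Set.finite_range _).subset hsub
    have hApow : ∀ a ∈ A, a ^ p = 1 := by
      have hle : A ≤ T ⊓ Subgroup.closure {y | y ∈ T ∧ y ^ p = 1} := by
        refine le_inf hAT (Subgroup.closure_mono ?_)
        intro y hy
        refine ⟨hAT (Subgroup.subset_closure hy), ?_⟩
        obtain ⟨x', hx', hc⟩ := Group.mem_conjugatesOfSet_iff.1 hy
        obtain rfl : x' = x := hx'
        obtain ⟨q, rfl⟩ := isConj_iff.1 hc
        rw [conj_pow, hxp]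
        simp
      intro a ha
      have ha' := (hle ha).2
      have : ∀ a ∈ Subgroup.closure {y | y ∈ T ∧ y ^ p = 1}, a ∈ T ∧ a ^ p = 1 := by
        intro a ha
        induction ha using Subgroup.closure_induction with
        | mem y hy => exact hy
        | one => exact ⟨one_mem _, one_pow _⟩
        | mul y z _ _ hy hz =>
          refine ⟨mul_mem hy.1 hz.1, ?_⟩
          rw [Commute.mul_pow (hcomm y hy.1 z hz.1), hy.2, hz.2, one_mul]
        | inv y _ hy => exact ⟨inv_mem hy.1, by rw [inv_pow, hy.2, inv_one]⟩
      exact (this a ha').2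
    have hApow' : ∀ a : A, a ^ p = 1 := fun a => Subtype.ext (hApow a a.2)
    have hfg : Group.FG A := by
      rw [Group.fg_iff_subgroup_fg]
      exact ⟨hfinconj.toFinset, by rw [Set.Finite.coe_toFinset]; rfl⟩
    have hfin : Finite A := CommGroup.finite_of_fg_isMulTorsion A
      ((fun a => isOfFinOrder_iff_pow_eq_one.2
        ⟨p, (Fact.out : p.Prime).pos, hApow' a⟩))
    have hA : IsPGroup p A := fun a => ⟨1, by rw [pow_one, hApow' a]⟩
    have hxA : x ∈ A := Subgroup.subset_normalClosure rfl
    obtain ⟨z, hz, hz1, hzc⟩ := exists_central_of_normal A T hA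
      (fun h => hx1 (by rwa [h, Subgroup.mem_bot] at hxA))
      (fun a ha t ht => hcomm t ht a (hAT ha)) hpow
    obtain ⟨y, rfl⟩ := hdiv z (hAT hz)
    exact ⟨_, pow_mem_commutatorPow y, hz1, hApow _ hz, hzc⟩

end Abstract

/-! ### Torsion of tori -/

theorem Circle.exists_pow_eq {k : ℕ} (hk : k ≠ 0) (z : Circle) : ∃ w : Circle, w ^ k = z := by
  refine ⟨Circle.exp (Complex.arg z / k), ?_⟩
  rw [← Circle.exp_nsmul, nsmul_eq_mul, mul_div_cancel₀ _ (Nat.cast_ne_zero.2 hk),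
    Circle.exp_arg]

/-- Density of the `p`-power roots of unity, by rounding the angle down to a multiple of `2π / p ^
k`. -/
theorem Circle.exists_seq_torsion {p : ℕ} (hp : 1 < p) (z : Circle) :
    ∃ w : ℕ → Circle, (∀ k, w k ^ p ^ k = 1) ∧ Filter.Tendsto w Filter.atTop (𝓝 z) := by
  have hpi := Real.two_pi_pos
  -- The extra full turn makes the angle nonnegative, as the natural-number floor requires.
  set a : ℝ := Complex.arg z / (2 * Real.pi) + 1 with ha
  have ha0 : 0 ≤ a := by
    have h1 := Complex.neg_pi_lt_arg (z : ℂ)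
    rw [ha, div_add_one hpi.ne']
    exact div_nonneg (by linarith [Real.pi_pos]) hpi.le
  have hz : Circle.exp (2 * Real.pi * a) = z := by
    rw [ha, mul_add, mul_div_cancel₀ _ hpi.ne', mul_one, Circle.exp_add, Circle.exp_two_pi,
      mul_one, Circle.exp_arg]
  have hpk : Filter.Tendsto (fun k : ℕ => (p : ℝ) ^ k) Filter.atTop Filter.atTop :=
    tendsto_pow_atTop_atTop_of_one_lt (by exact_mod_cast hp)
  refine ⟨fun k => Circle.exp (2 * Real.pi * (⌊a * (p : ℝ) ^ k⌋₊ / (p : ℝ) ^ k)), fun k => ?_, ?_⟩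
  · have h0 : (p : ℝ) ^ k ≠ 0 := pow_ne_zero _ (by positivity)
    rw [← Circle.exp_nsmul, nsmul_eq_mul]
    have : ((p ^ k : ℕ) : ℝ) * (2 * Real.pi * (⌊a * (p : ℝ) ^ k⌋₊ / (p : ℝ) ^ k)) =
        (⌊a * (p : ℝ) ^ k⌋₊ : ℝ) * (2 * Real.pi) := by
      push_cast
      field_simp
    rw [this, ← nsmul_eq_mul, Circle.exp_nsmul, Circle.exp_two_pi, one_pow]
  · rw [← hz]
    exact (Circle.exp.continuous.tendsto _).comp
      (((tendsto_nat_floor_mul_div_atTop ha0).comp hpk).const_mul _)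

/-- The `p`-power torsion is dense in the torus and the kernel is closed, so a nontrivial `φ` cannot
kill all of the torsion. -/
theorem exists_torsion_of_torus {p : ℕ} (hp : p.Prime) {r : ℕ} {Q : Type} [Group Q]
    (φ : (Fin r → Circle) →* Q) (hφ : IsClosed {x | φ x = 1}) (hne : ∃ x, φ x ≠ 1) :
    ∃ x, φ x ≠ 1 ∧ φ x ^ p = 1 := by
  obtain ⟨x, hx⟩ := hne
  choose w hw hlim using fun i => Circle.exists_seq_torsion hp.one_lt (x i)
  have hlim' : Filter.Tendsto (fun k i => w i k) Filter.atTop (𝓝 x) :=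
    tendsto_pi_nhds.2 hlim
  obtain ⟨k, hk⟩ : ∃ k, φ (fun i => w i k) ≠ 1 := by
    by_contra hcon
    push Not at hcon
    exact hx (hφ.mem_of_tendsto hlim' (Filter.Eventually.of_forall hcon))
  have hpow : φ (fun i => w i k) ^ p ^ k = 1 := by
    rw [← map_pow, ← map_one φ]
    congr 1
    funext i
    exact hw i k
  obtain ⟨j, hj, hj'⟩ := exists_pow_of_pow_prime_pow hk hpow
  exact ⟨(fun i => w i k) ^ p ^ j, by rwa [map_pow], by rwa [map_pow]⟩

/-! ### Projective images of `p`-toral subgroups -/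

theorem isClosed_scalarCircle (n : ℕ) : IsClosed (scalarCircle n : Set (UGroup n)) := by
  let f : Circle → UGroup n := fun z => ⟨(z : ℂ) • 1, by
    rw [Matrix.mem_unitaryGroup_iff, star_smul, star_one, smul_mul_smul_comm, mul_one,
      Complex.star_def, Complex.mul_conj, Circle.normSq_coe, Complex.ofReal_one, one_smul]⟩
  have hf : Continuous f :=
    Continuous.subtype_mk ((continuous_subtype_val : Continuous fun z : Circle => (z : ℂ)).smul continuous_const) _
  have : (scalarCircle n : Set (UGroup n)) = Set.range f := by
    ext A
    constructor
    · rintro ⟨z, hz⟩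
      exact ⟨z, Subtype.ext hz.symm⟩
    · rintro ⟨z, rfl⟩
      exact ⟨z, rfl⟩
  rw [this]
  exact (isCompact_range hf).isClosed

/-- A `p`-toral subgroup of `U(n)` whose projective image is not an elementary abelian `p`-group
contains an element that is central of order `p` modulo scalars and lies in every subgroup
containing the scalars, the commutators and the `p`-th powers. -/
theorem exists_central_of_not_isElementaryAbelian {p : ℕ} (hp : p.Prime) {n : ℕ}
    {H : Subgroup (UGroup n)} (htoral : IsPToral p H)
    (hne : ¬ IsElementaryAbelian p (projImage H)) :
    ∃ g ∈ H, g ∉ scalarCircle n ∧ g ^ p ∈ scalarCircle n ∧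
      (∀ h ∈ H, (h * g)⁻¹ * (g * h) ∈ scalarCircle n) ∧
      ∀ K : Subgroup (UGroup n), scalarCircle n ≤ K → (∀ a ∈ H, ∀ b ∈ H, ⁅a, b⁆ ∈ K) →
        (∀ a ∈ H, a ^ p ∈ K) → g ∈ K := by
  have := Fact.mk hp
  obtain ⟨T, hTn, ⟨r, ⟨e⟩⟩, hfin, hP⟩ := htoral
  let π : UGroup n →* PUGroup n := QuotientGroup.mk' (scalarCircle n)
  let ψ : H →* projImage H := π.subgroupMap H
  have hψ : Function.Surjective ψ := π.subgroupMap_surjective H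
  have hψ1 : ∀ x : H, ψ x = 1 ↔ (x : UGroup n) ∈ scalarCircle n := fun x => by
    rw [← QuotientGroup.eq_one_iff, Subtype.ext_iff]
    rfl
  have hTn' : (T.map ψ).Normal := hTn.map ψ hψ
  let q : H ⧸ T →* projImage H ⧸ T.map ψ := QuotientGroup.map T (T.map ψ) ψ (T.le_comap_map ψ)
  have hq : Function.Surjective q := by
    intro x
    obtain ⟨x, rfl⟩ := QuotientGroup.mk_surjective x
    obtain ⟨h, rfl⟩ := hψ x
    exact ⟨h, rfl⟩
  have hfin' : Finite (projImage H ⧸ T.map ψ) := Finite.of_surjective q hq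
  let φ : (Fin r → Circle) →* projImage H := (ψ.comp T.subtype).comp e.symm.toMonoidHom
  have hφ : IsClosed {x | φ x = 1} := by
    have : {x | φ x = 1} = (fun x => (((e.symm x : T) : H) : UGroup n)) ⁻¹' (scalarCircle n) := by
      ext x
      exact hψ1 _
    rw [this]
    exact (isClosed_scalarCircle n).preimage
      (continuous_subtype_val.comp (continuous_subtype_val.comp e.symm.continuous))
  have hφT : ∀ x, φ x ∈ T.map ψ := fun x => ⟨_, (e.symm x).2, rfl⟩
  have hTφ : ∀ y ∈ T.map ψ, ∃ x, φ x = y := by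
    rintro _ ⟨t, ht, rfl⟩
    refine ⟨e ⟨t, ht⟩, ?_⟩
    change ψ (e.symm (e ⟨t, ht⟩) : T) = ψ t
    rw [ContinuousMulEquiv.symm_apply_apply]
  obtain ⟨z, hzΦ, hz1, hzp, hzc⟩ := exists_central_mem_commutatorPow (T.map ψ)
    (by
      intro x hx y hy
      obtain ⟨x, rfl⟩ := hTφ x hx
      obtain ⟨y, rfl⟩ := hTφ y hy
      rw [← map_mul, ← map_mul, mul_comm])
    (hP.of_surjective q hq)
    (by
      intro x hx
      obtain ⟨x, rfl⟩ := hTφ x hx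
      choose w hw using fun i => Circle.exists_pow_eq hp.ne_zero (x i)
      refine ⟨φ w, ?_⟩
      rw [← map_pow]
      congr 1
      funext i
      exact hw i)
    (by
      intro hT
      obtain ⟨⟨y, hy⟩, hy1⟩ := Subgroup.ne_bot_iff_exists_ne_one.1 hT
      obtain ⟨x, rfl⟩ := hTφ y hy
      obtain ⟨x', hx', hxp⟩ := exists_torsion_of_torus hp φ hφ
        ⟨x, fun h => hy1 (Subtype.ext h)⟩
      exact ⟨_, hφT x', hx', hxp⟩)
    hne
  obtain ⟨g, rfl⟩ := hψ z
  refine ⟨g, g.2, fun h => hz1 ((hψ1 g).2 h), ?_, ?_, ?_⟩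
  · rw [← map_pow, hψ1] at hzp
    exact hzp
  · intro h hh
    have := hzc (ψ ⟨h, hh⟩)
    rw [← map_mul, ← map_mul, ← inv_mul_eq_one, ← map_inv, ← map_mul, hψ1] at this
    exact this
  · intro K hS hcomm hpow
    -- The image of `K` contains the generators of the Frattini-type subgroup; hence `g` differs
    -- from an element of `K` by a scalar, and `K` contains the scalars.
    have hle : commutatorPow p (projImage H) ≤ (K.map π).subgroupOf (projImage H) := by
      rw [commutatorPow, Subgroup.closure_le]
      rintro x (⟨a, b, rfl⟩ | ⟨a, rfl⟩)
      · obtain ⟨a, rfl⟩ := hψ a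
        obtain ⟨b, rfl⟩ := hψ b
        exact ⟨_, hcomm a a.2 b b.2, rfl⟩
      · obtain ⟨a, rfl⟩ := hψ a
        exact ⟨_, hpow a a.2, rfl⟩
    obtain ⟨k, hk, hkg⟩ := hle hzΦ
    have h1 : k⁻¹ * g ∈ scalarCircle n := QuotientGroup.eq.1 hkg
    have := mul_mem hk (hS h1)
    rwa [mul_inv_cancel_left] at this

/-! ### The action of `U(n)` on subspaces -/

namespace UGroup

variable {n : ℕ}

/-- The isometry of `ℂⁿ` given by a unitary matrix. -/
def isometry (A : UGroup n) : CSpace n ≃ₗᵢ[ℂ] CSpace n :=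
  Unitary.linearIsometryEquiv
    ⟨Matrix.toEuclideanCLM (n := Fin n) (𝕜 := ℂ) A.1, Unitary.map_mem _ A.2⟩

theorem isometry_one (x : CSpace n) : isometry 1 x = x := by
  have : Matrix.toEuclideanCLM (n := Fin n) (𝕜 := ℂ) (1 : Matrix (Fin n) (Fin n) ℂ) = 1 := map_one _
  exact DFunLike.congr_fun this x

theorem isometry_mul (A B : UGroup n) (x : CSpace n) :
    isometry (A * B) x = isometry A (isometry B x) := by
  have : Matrix.toEuclideanCLM (n := Fin n) (𝕜 := ℂ) (A.1 * B.1) =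
    Matrix.toEuclideanCLM (n := Fin n) (𝕜 := ℂ) A.1 *
      Matrix.toEuclideanCLM (n := Fin n) (𝕜 := ℂ) B.1 := map_mul _ _ _
  exact DFunLike.congr_fun this x

theorem isometry_of_coe_eq_smul {A : UGroup n} {z : ℂ}
    (h : (A : Matrix (Fin n) (Fin n) ℂ) = z • 1) (x : CSpace n) : isometry A x = z • x := by
  have h1 : Matrix.toEuclideanCLM (n := Fin n) (𝕜 := ℂ) A.1 = z • 1 := by
    rw [h, map_smul, map_one]
  exact DFunLike.congr_fun h1 x

theorem coe_eq_smul_of_isometry {A : UGroup n} {z : ℂ} (h : ∀ x, isometry A x = z • x) :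
    (A : Matrix (Fin n) (Fin n) ℂ) = z • 1 := by
  have h1 : Matrix.toEuclideanCLM (n := Fin n) (𝕜 := ℂ) A.1 =
      Matrix.toEuclideanCLM (n := Fin n) (𝕜 := ℂ) (z • 1) := by
    rw [map_smul, map_one]
    ext1 x
    exact h x
  exact EquivLike.injective _ h1

instance : MulAction (UGroup n) (Submodule ℂ (CSpace n)) where
  smul A V := V.map (Matrix.toEuclideanLin (A : Matrix (Fin n) (Fin n) ℂ))
  one_smul V := by
    ext x
    constructor
    · rintro ⟨y, hy, rfl⟩
      exact (isometry_one y).symm ▸ hy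
    · exact fun hx => ⟨x, hx, isometry_one x⟩
  mul_smul A B V := by
    ext x
    constructor
    · rintro ⟨y, hy, rfl⟩
      exact ⟨_, ⟨y, hy, rfl⟩, (isometry_mul A B y).symm⟩
    · rintro ⟨_, ⟨y, hy, rfl⟩, rfl⟩
      exact ⟨y, hy, isometry_mul A B y⟩

theorem smul_bot (A : UGroup n) : A • (⊥ : Submodule ℂ (CSpace n)) = ⊥ := Submodule.map_bot _

theorem smul_eq_bot_iff {A : UGroup n} {V : Submodule ℂ (CSpace n)} : A • V = ⊥ ↔ V = ⊥ := by
  rw [smul_eq_iff_eq_inv_smul, smul_bot]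

theorem smul_mono (A : UGroup n) {V W : Submodule ℂ (CSpace n)} (h : V ≤ W) : A • V ≤ A • W :=
  Submodule.map_mono h

theorem smul_iSup {ι : Type} (A : UGroup n) (V : ι → Submodule ℂ (CSpace n)) :
    A • (⨆ i, V i) = ⨆ i, A • V i := Submodule.map_iSup _ _

theorem smul_inf (A : UGroup n) (V W : Submodule ℂ (CSpace n)) :
    A • (V ⊓ W) = A • V ⊓ A • W :=
  Submodule.map_inf _ (isometry A).injective

theorem starProjection_smul (A : UGroup n) (V : Submodule ℂ (CSpace n)) :
    (A • V).starProjection = ((isometry A : CSpace n →L[ℂ] CSpace n).comp V.starProjection).comp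
      ((isometry A).symm : CSpace n →L[ℂ] CSpace n) := by
  ext1 x
  exact Submodule.starProjection_map_apply (isometry A) V x

theorem smul_eq_self_of_mem_scalarCircle {A : UGroup n} (h : A ∈ scalarCircle n)
    (V : Submodule ℂ (CSpace n)) : A • V = V := by
  have hle : ∀ B ∈ scalarCircle n, B • V ≤ V := by
    rintro B ⟨z, hz⟩ _ ⟨y, hy, rfl⟩
    have := isometry_of_coe_eq_smul hz y
    change isometry B y ∈ V
    rw [this]
    exact V.smul_mem _ hy
  refine le_antisymm (hle A h) ?_
  have := smul_mono A (hle A⁻¹ (inv_mem h))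
  rwa [smul_inv_smul] at this

/-- Scalars fix every subspace, so commuting modulo scalars is commuting on subspaces. -/
theorem smul_comm_of_mem_scalarCircle {g h : UGroup n} (hc : (h * g)⁻¹ * (g * h) ∈ scalarCircle n)
    (V : Submodule ℂ (CSpace n)) : h • g • V = g • h • V := by
  have := smul_eq_self_of_mem_scalarCircle hc V
  rw [mul_smul, inv_smul_eq_iff, mul_smul, mul_smul] at this
  exact this.symm

theorem smul_zpow_comm_of_mem_scalarCircle {g h : UGroup n}
    (hc : (h * g)⁻¹ * (g * h) ∈ scalarCircle n) (k : ℤ) (V : Submodule ℂ (CSpace n)) :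
    h • g ^ k • V = g ^ k • h • V := by
  let τ := MulAction.toPermHom (UGroup n) (Submodule ℂ (CSpace n))
  have h1 : Commute (τ h) (τ g) := Equiv.ext (smul_comm_of_mem_scalarCircle hc)
  have h2 := h1.zpow_right k
  rw [← map_zpow] at h2
  exact Equiv.congr_fun h2.eq V

end UGroup

theorem UPartition.isWeaklyFixed_iff {n : ℕ} {H : Subgroup (UGroup n)} {l : UPartition n} :
    l.IsWeaklyFixed H ↔ ∀ h ∈ H, ∀ V ∈ l.classes, h • V ∈ l.classes := by
  constructor
  · intro hl h hh V hV
    rw [← hl h hh]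
    exact ⟨V, hV, rfl⟩
  · intro hl h hh
    refine Set.Subset.antisymm ?_ ?_
    · rintro _ ⟨V, hV, rfl⟩
      exact hl h hh V hV
    · intro V hV
      exact ⟨h⁻¹ • V, hl _ (inv_mem hh) V hV, smul_inv_smul h V⟩

/-! ### Orbit spans and eigenspaces -/

section Spans

variable {n : ℕ} (g : UGroup n)

/-- The span of the translates of a subspace by the powers of `g`. -/
def orbitSpan (V : Submodule ℂ (CSpace n)) : Submodule ℂ (CSpace n) := ⨆ k : ℤ, g ^ k • V

/-- The eigenspaces of `g`. -/
def eigSpace (ζ : ℂ) : Submodule ℂ (CSpace n) :=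
  Module.End.eigenspace (Matrix.toEuclideanLin (g : Matrix (Fin n) (Fin n) ℂ)) ζ

variable {g}

theorem mem_eigSpace {ζ : ℂ} {x : CSpace n} : x ∈ eigSpace g ζ ↔ UGroup.isometry g x = ζ • x :=
  Module.End.mem_eigenspace_iff

theorem le_orbitSpan (V : Submodule ℂ (CSpace n)) : V ≤ orbitSpan g V := by
  refine le_iSup_of_le 0 ?_
  rw [zpow_zero, one_smul]

theorem orbitSpan_mono {V W : Submodule ℂ (CSpace n)} (h : V ≤ W) : orbitSpan g V ≤ orbitSpan g W :=
  iSup_mono fun _ => UGroup.smul_mono _ h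

theorem orbitSpan_zpow_smul (k : ℤ) (V : Submodule ℂ (CSpace n)) :
    orbitSpan g (g ^ k • V) = orbitSpan g V := by
  unfold orbitSpan
  simp only [smul_smul, ← zpow_add]
  exact (Equiv.addRight k).surjective.iSup_comp fun j => g ^ j • V

theorem smul_orbitSpan {h : UGroup n} (hc : (h * g)⁻¹ * (g * h) ∈ scalarCircle n)
    (V : Submodule ℂ (CSpace n)) : h • orbitSpan g V = orbitSpan g (h • V) := by
  unfold orbitSpan
  rw [UGroup.smul_iSup]
  simp only [UGroup.smul_zpow_comm_of_mem_scalarCircle hc]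

theorem smul_self_orbitSpan (V : Submodule ℂ (CSpace n)) : g • orbitSpan g V = orbitSpan g V := by
  rw [smul_orbitSpan (by rw [inv_mul_cancel]; exact one_mem _)]
  simpa using orbitSpan_zpow_smul (g := g) 1 V

/-- If `g h = z h g` with `z` scalar, then `h` carries the `ζ`-eigenspace onto the `zζ`-eigenspace.
-/
theorem smul_eigSpace {h : UGroup n} (hc : (h * g)⁻¹ * (g * h) ∈ scalarCircle n) (ζ : ℂ) :
    ∃ ξ, h • eigSpace g ζ = eigSpace g ξ := by
  obtain ⟨z, hz⟩ := hc
  have hcomm : ∀ x, UGroup.isometry g (UGroup.isometry h x) =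
      (z : ℂ) • UGroup.isometry h (UGroup.isometry g x) := by
    intro x
    have h1 := UGroup.isometry_of_coe_eq_smul hz x
    have h2 : UGroup.isometry (h * g) (UGroup.isometry ((h * g)⁻¹ * (g * h)) x) =
        UGroup.isometry (g * h) x := by
      rw [← UGroup.isometry_mul, mul_inv_cancel_left]
    rw [h1, map_smul, UGroup.isometry_mul, UGroup.isometry_mul] at h2
    exact h2.symm
  refine ⟨z * ζ, le_antisymm ?_ ?_⟩
  · rintro _ ⟨x, hx, rfl⟩
    have hx' := mem_eigSpace.1 hx
    change UGroup.isometry h x ∈ _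
    rw [mem_eigSpace, hcomm, hx', map_smul, smul_smul]
  · intro y hy
    obtain ⟨x, rfl⟩ := (UGroup.isometry h).surjective y
    refine ⟨x, ?_, rfl⟩
    rw [mem_eigSpace, hcomm, mul_smul] at hy
    have := smul_right_injective _ z.coe_ne_zero hy
    rw [← map_smul] at this
    exact mem_eigSpace.2 ((UGroup.isometry h).injective this)

theorem eigSpace_isOrtho {ζ ξ : ℂ} (h : ζ ≠ ξ) : eigSpace g ζ ⟂ eigSpace g ξ := by
  rw [Submodule.isOrtho_iff_inner_eq]
  intro x hx y hy
  by_contra hne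
  rw [mem_eigSpace] at hx hy
  have hx0 : x ≠ 0 := fun h0 => hne (by simp [h0])
  have h1 := (UGroup.isometry g).norm_map x
  rw [hx, norm_smul, mul_eq_right₀ (norm_ne_zero_iff.2 hx0)] at h1
  have h2 := (UGroup.isometry g).inner_map_map x y
  rw [hx, hy, inner_smul_left, inner_smul_right, ← mul_assoc, mul_eq_right₀ hne] at h2
  apply h
  have h3 : ζ * (starRingEnd ℂ) ζ = 1 := by
    rw [Complex.mul_conj, Complex.normSq_eq_norm_sq, h1]; simp
  calc ζ = ζ * ((starRingEnd ℂ) ζ * ξ) := by rw [h2, mul_one]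
    _ = ξ := by rw [← mul_assoc, h3, one_mul]

/-- With `g ^ p = z`, the separable polynomial `X ^ p - z` annihilates `g`, so `g` is
diagonalizable. -/
theorem iSup_eigSpace {p : ℕ} (hp : p ≠ 0) (hg : g ^ p ∈ scalarCircle n) :
    ⨆ ζ, eigSpace g ζ = ⊤ := by
  obtain ⟨z, hz⟩ := hg
  let f : Module.End ℂ (CSpace n) := Matrix.toEuclideanLin (g : Matrix (Fin n) (Fin n) ℂ)
  have hpow : ∀ (k : ℕ) (x : CSpace n), (f ^ k) x = UGroup.isometry (g ^ k) x := by
    intro k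
    induction k with
    | zero => intro x; rw [pow_zero, pow_zero, UGroup.isometry_one]; rfl
    | succ k ih =>
      intro x
      rw [pow_succ, pow_succ, UGroup.isometry_mul, ← ih]
      rfl
  have haeval : Polynomial.aeval f (Polynomial.X ^ p - Polynomial.C (z : ℂ)) = 0 := by
    ext1 x
    rw [map_sub, map_pow, Polynomial.aeval_X, Polynomial.aeval_C, LinearMap.sub_apply, hpow,
      UGroup.isometry_of_coe_eq_smul hz, Module.algebraMap_end_apply, sub_self]
    rfl
  have hsep : (Polynomial.X ^ p - Polynomial.C (z : ℂ)).Separable :=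
    Polynomial.separable_X_pow_sub_C _ (Nat.cast_ne_zero.2 hp) z.coe_ne_zero
  have hss := Module.End.isSemisimple_of_squarefree_aeval_eq_zero hsep.squarefree haeval
  have h := Module.End.iSup_maxGenEigenspace_eq_top f
  simp only [hss.isFinitelySemisimple.maxGenEigenspace_eq_eigenspace] at h
  exact h

/-- The projections of invariant subspaces preserve the eigenspaces. -/
theorem starProjection_mem_eigSpace {W : Submodule ℂ (CSpace n)} (hW : g • W = W) {ζ : ℂ}
    {x : CSpace n} (hx : x ∈ eigSpace g ζ) : W.starProjection x ∈ eigSpace g ζ := by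
  rw [mem_eigSpace] at hx ⊢
  have h := Submodule.starProjection_map_apply (UGroup.isometry g) W (UGroup.isometry g x)
  rw [LinearIsometryEquiv.symm_apply_apply, hx, map_smul] at h
  change ζ • (g • W).starProjection x = _ at h
  rw [hW] at h
  exact h.symm

/-- The projection onto an invariant `W` preserves eigenspaces. The product formula makes the
intersection depend continuously on `W`, which fails for general subspaces. -/
theorem starProjection_inf_eigSpace {W : Submodule ℂ (CSpace n)} (hW : g • W = W) (ζ : ℂ) :
    (W ⊓ eigSpace g ζ).starProjection =
      W.starProjection.comp (eigSpace g ζ).starProjection := by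
  ext1 x
  set y := (eigSpace g ζ).starProjection x with hy
  refine Submodule.eq_starProjection_of_mem_of_inner_eq_zero (v := W.starProjection y)
    ⟨W.starProjection_apply_mem y,
      starProjection_mem_eigSpace hW ((eigSpace g ζ).starProjection_apply_mem x)⟩ ?_
  intro w hw
  have h1 := Submodule.starProjection_inner_eq_zero (K := eigSpace g ζ) x w hw.2
  have h2 := Submodule.starProjection_inner_eq_zero (K := W) y w hw.1
  rw [← sub_add_sub_cancel x y, inner_add_left, h1, h2, add_zero]

theorem iSup_inf_eigSpace (htop : ⨆ ζ, eigSpace g ζ = ⊤) {W : Submodule ℂ (CSpace n)}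
    (hW : g • W = W) : ⨆ ζ, W ⊓ eigSpace g ζ = W := by
  refine le_antisymm (iSup_le fun ζ => inf_le_left) fun x hx => ?_
  have h1 : Submodule.map (W.starProjection : CSpace n →ₗ[ℂ] CSpace n) (⨆ ζ, eigSpace g ζ) ≤
      ⨆ ζ, W ⊓ eigSpace g ζ := by
    rw [Submodule.map_iSup]
    refine iSup_mono fun ζ => ?_
    rintro _ ⟨y, hy, rfl⟩
    exact ⟨W.starProjection_apply_mem y, starProjection_mem_eigSpace hW hy⟩
  rw [htop] at h1
  have h2 := h1 ⟨x, trivial, rfl⟩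
  change W.starProjection x ∈ _ at h2
  rwa [Submodule.starProjection_eq_self_iff.2 hx] at h2

/-- The projection onto the span of orthogonal subspaces is the sum of the projections. -/
theorem starProjection_biSup {m : ℕ} {v : Fin m → Submodule ℂ (CSpace n)}
    (hv : ∀ i j, i ≠ j → v i ⟂ v j) (S : Finset (Fin m)) :
    (⨆ j ∈ S, v j).starProjection = ∑ j ∈ S, (v j).starProjection := by
  ext1 x
  rw [_root_.sum_apply]
  refine Submodule.eq_starProjection_of_mem_of_inner_eq_zero ?_ ?_
  · exact Submodule.sum_mem _ fun j hj =>
      (le_iSup₂ (f := fun j (_ : j ∈ S) => v j) j hj) ((v j).starProjection_apply_mem x)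
  · intro w hw
    rw [← Submodule.mem_orthogonal_singleton_iff_inner_right]
    refine (iSup₂_le (f := fun j (_ : j ∈ S) => v j) fun j hj => ?_) hw
    intro w hw
    rw [Submodule.mem_orthogonal_singleton_iff_inner_right, inner_sub_left, sum_inner,
      Finset.sum_eq_single_of_mem j hj, ← inner_sub_left]
    · exact Submodule.starProjection_inner_eq_zero (K := v j) x w hw
    · intro i _ hij
      exact (hv i j hij).inner_eq ((v i).starProjection_apply_mem x) hw

end Spans

/-! ### Coarsening by orbits and refinement by eigenspaces -/

section Decompositions

variable {n : ℕ} {g : UGroup n} {s : Set (Submodule ℂ (CSpace n))}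

variable (g s) in
/-- The set of spans of the orbits of `g` on a set of subspaces. -/
def orbitCoarsening : Set (Submodule ℂ (CSpace n)) := orbitSpan g '' s

variable (g s) in
/-- The set of nonzero intersections of the subspaces in a set with the eigenspaces of `g`. -/
def eigRefinement : Set (Submodule ℂ (CSpace n)) :=
  {U | ∃ V ∈ s, ∃ ζ, V ⊓ eigSpace g ζ = U} \ {⊥}

variable (g) in
/-- The set of nonzero eigenspaces of `g`. -/
def eigDecomposition : Set (Submodule ℂ (CSpace n)) := Set.range (eigSpace g) \ {⊥}

theorem isOrtho_orbitSpan (hs : IsOrthogonalDecomposition s)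
    (hg : ∀ (k : ℤ), ∀ V ∈ s, g ^ k • V ∈ s) {V W : Submodule ℂ (CSpace n)} (hV : V ∈ s)
    (hW : W ∈ s) (h : ∀ k : ℤ, g ^ k • V ≠ W) : orbitSpan g V ⟂ orbitSpan g W := by
  simp only [orbitSpan, Submodule.isOrtho_iSup_left, Submodule.isOrtho_iSup_right]
  intro j k
  refine hs.pairwise (hg k V hV) (hg j W hW) fun hkj => h (-j + k) ?_
  rw [zpow_add, mul_smul, hkj, zpow_neg, inv_smul_smul]

theorem orbitSpan_ne_bot (hs : IsOrthogonalDecomposition s) {V : Submodule ℂ (CSpace n)}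
    (hV : V ∈ s) : orbitSpan g V ≠ ⊥ := fun h =>
  hs.bot_notMem (le_bot_iff.1 ((le_orbitSpan V).trans h.le) ▸ hV)

theorem isOrthogonalDecomposition_orbitCoarsening (hs : IsOrthogonalDecomposition s)
    (hg : ∀ (k : ℤ), ∀ V ∈ s, g ^ k • V ∈ s)
    (hnt : ∃ V ∈ s, ∃ W ∈ s, ∀ k : ℤ, g ^ k • V ≠ W) :
    IsOrthogonalDecomposition (orbitCoarsening g s) where
  finite := hs.finite.image _
  bot_notMem := by
    rintro ⟨V, hV, h⟩
    exact orbitSpan_ne_bot hs hV h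
  pairwise := by
    rintro _ ⟨V, hV, rfl⟩ _ ⟨W, hW, rfl⟩ hne
    refine isOrtho_orbitSpan hs hg hV hW ?_
    rintro k rfl
    exact hne (orbitSpan_zpow_smul k V).symm
  sSup_eq := by
    rw [eq_top_iff, ← hs.sSup_eq]
    exact sSup_le fun V hV => (le_orbitSpan V).trans (le_sSup ⟨V, hV, rfl⟩)
  nontrivial := by
    obtain ⟨V, hV, W, hW, h⟩ := hnt
    refine ⟨_, ⟨V, hV, rfl⟩, _, ⟨W, hW, rfl⟩, fun heq => ?_⟩
    have h1 := isOrtho_orbitSpan hs hg hV hW h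
    rw [heq, Submodule.isOrtho_self] at h1
    exact orbitSpan_ne_bot hs hW h1

variable (g) in
theorem finite_nonzero_eigSpace : {ζ : ℂ | eigSpace g ζ ≠ ⊥}.Finite :=
  Module.End.finite_hasEigenvalue (Matrix.toEuclideanLin (g : Matrix (Fin n) (Fin n) ℂ))

theorem isOrthogonalDecomposition_eigRefinement (hs : IsOrthogonalDecomposition s)
    (hg : ∀ V ∈ s, g • V = V) (htop : ⨆ ζ, eigSpace g ζ = ⊤) :
    IsOrthogonalDecomposition (eigRefinement g s) where
  finite := by
    refine ((hs.finite.prod (finite_nonzero_eigSpace g)).image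
      fun x => x.1 ⊓ eigSpace g x.2).subset ?_
    rintro _ ⟨⟨V, hV, ζ, rfl⟩, h⟩
    refine ⟨(V, ζ), ⟨hV, fun h0 => h ?_⟩, rfl⟩
    change V ⊓ eigSpace g ζ = ⊥
    rw [show eigSpace g ζ = ⊥ from h0, inf_bot_eq]
  bot_notMem h := h.2 rfl
  pairwise := by
    rintro _ ⟨⟨V, hV, ζ, rfl⟩, -⟩ _ ⟨⟨W, hW, ξ, rfl⟩, -⟩ hne
    by_cases h : V = W
    · subst h
      exact (eigSpace_isOrtho fun hζ => hne (by rw [hζ])).mono inf_le_right inf_le_right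
    · exact (hs.pairwise hV hW h).mono inf_le_left inf_le_left
  sSup_eq := by
    rw [eq_top_iff, ← hs.sSup_eq]
    refine sSup_le fun V hV => ?_
    rw [← iSup_inf_eigSpace htop (hg V hV)]
    refine iSup_le fun ζ => ?_
    by_cases h : V ⊓ eigSpace g ζ = ⊥
    · rw [h]; exact bot_le
    · exact le_sSup ⟨⟨V, hV, ζ, rfl⟩, h⟩
  nontrivial := by
    obtain ⟨V, hV, W, hW, hVW⟩ := hs.nontrivial
    have hex : ∀ V ∈ s, ∃ ζ, V ⊓ eigSpace g ζ ≠ ⊥ := by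
      intro V hV
      by_contra hcon
      push Not at hcon
      have h := iSup_inf_eigSpace htop (hg V hV)
      simp only [hcon, iSup_bot] at h
      exact hs.bot_notMem (h ▸ hV)
    obtain ⟨ζ, hζ⟩ := hex V hV
    obtain ⟨ξ, hξ⟩ := hex W hW
    refine ⟨_, ⟨⟨V, hV, ζ, rfl⟩, hζ⟩, _, ⟨⟨W, hW, ξ, rfl⟩, hξ⟩, fun heq => hξ ?_⟩
    have h := (hs.pairwise hV hW hVW).mono (inf_le_left (b := eigSpace g ζ))
      (inf_le_left (b := eigSpace g ξ))
    rwa [heq, Submodule.isOrtho_self] at h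

theorem isOrthogonalDecomposition_eigDecomposition (hg : g ∉ scalarCircle n)
    (htop : ⨆ ζ, eigSpace g ζ = ⊤) : IsOrthogonalDecomposition (eigDecomposition g) where
  finite := by
    refine ((finite_nonzero_eigSpace g).image (eigSpace g)).subset ?_
    rintro _ ⟨⟨ζ, rfl⟩, h⟩
    exact ⟨ζ, h, rfl⟩
  bot_notMem h := h.2 rfl
  pairwise := by
    rintro _ ⟨⟨ζ, rfl⟩, -⟩ _ ⟨⟨ξ, rfl⟩, -⟩ hne
    exact eigSpace_isOrtho fun h => hne (by rw [h])
  sSup_eq := by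
    rw [eigDecomposition, sSup_sdiff_singleton_bot, sSup_range, htop]
  nontrivial := by
    by_contra hsub
    rw [Set.not_nontrivial_iff] at hsub
    apply hg
    have hscalar : ∀ z : Circle, (∀ x, UGroup.isometry g x = (z : ℂ) • x) → g ∈ scalarCircle n :=
      fun z hz => ⟨z, UGroup.coe_eq_smul_of_isometry hz⟩
    have hsup : sSup (eigDecomposition g) = ⊤ := by
      rw [eigDecomposition, sSup_sdiff_singleton_bot, sSup_range, htop]
    rcases hsub.eq_empty_or_singleton with h | ⟨U, h⟩
    -- Without nonzero eigenspaces the whole space is zero, and `g` is the scalar 1.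
    · rw [h, sSup_empty] at hsup
      have : Subsingleton (CSpace n) := by
        rw [← Submodule.subsingleton_iff ℂ]
        exact subsingleton_of_bot_eq_top hsup
      exact hscalar 1 fun x => Subsingleton.elim _ _
    · rw [h, sSup_singleton] at hsup
      have hU : U ∈ eigDecomposition g := h ▸ rfl
      obtain ⟨⟨ζ, rfl⟩, hbot⟩ := hU
      have hx : ∀ x, UGroup.isometry g x = ζ • x := fun x => mem_eigSpace.1 (hsup ▸ trivial)
      obtain ⟨x, -, hx0⟩ := Submodule.exists_mem_ne_zero_of_ne_bot hbot
      have h1 := (UGroup.isometry g).norm_map x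
      rw [hx, norm_smul, mul_eq_right₀ (norm_ne_zero_iff.2 hx0)] at h1
      exact hscalar ⟨ζ, mem_sphere_zero_iff_norm.2 h1⟩ hx

end Decompositions

/-! ### Elements acting intransitively -/

section Fixed

variable {n : ℕ} {H : Subgroup (UGroup n)} {g : UGroup n}

/-- If `g` is central of finite order modulo scalars and lies in every subgroup containing the
scalars, the commutators and the `p`-th powers, then it does not act transitively on an invariant
set with at least two elements. -/
theorem exists_not_same_orbit {p : ℕ} (hg : g ∈ H) (hgp : g ^ p ∈ scalarCircle n)
    (hc : ∀ h ∈ H, (h * g)⁻¹ * (g * h) ∈ scalarCircle n)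
    (hK : ∀ K : Subgroup (UGroup n), scalarCircle n ≤ K → (∀ a ∈ H, ∀ b ∈ H, ⁅a, b⁆ ∈ K) →
      (∀ a ∈ H, a ^ p ∈ K) → g ∈ K)
    {s : Set (Submodule ℂ (CSpace n))} (hs : ∀ h ∈ H, ∀ V ∈ s, h • V ∈ s) (hnt : s.Nontrivial) :
    ∃ V ∈ s, ∃ W ∈ s, ∀ k : ℤ, g ^ k • V ≠ W := by
  by_contra! hcon
  -- If `h V = g ^ k V`, then `h` agrees with `g ^ k` on every `g ^ j V`, hence on all of `s` by
  -- transitivity.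
  have hact : ∀ h ∈ H, ∃ k : ℤ, ∀ W ∈ s, h • W = g ^ k • W := by
    intro h hh
    obtain ⟨V, hV⟩ := hnt.nonempty
    obtain ⟨k, hk⟩ := hcon V hV _ (hs h hh V hV)
    refine ⟨k, fun W hW => ?_⟩
    obtain ⟨j, rfl⟩ := hcon V hV W hW
    rw [UGroup.smul_zpow_comm_of_mem_scalarCircle (hc h hh), ← hk, smul_smul, smul_smul,
      ← zpow_add, ← zpow_add, add_comm]
  have hmem : ∀ (k : ℤ), ∀ W ∈ s, g ^ k • W ∈ s := fun k W hW => hs _ (zpow_mem hg k) W hW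
  -- Powers of `g` commute and their `p`-th powers act trivially, so the pointwise stabilizer of `s`
  -- contains all that forces `g` into it.
  have hgK : g ∈ fixingSubgroup (UGroup n) s := by
    refine hK _ ?_ ?_ ?_
    · intro z hz
      rw [mem_fixingSubgroup_iff]
      exact fun W _ => UGroup.smul_eq_self_of_mem_scalarCircle hz W
    · intro a ha b hb
      rw [mem_fixingSubgroup_iff]
      intro W hW
      obtain ⟨k, hk⟩ := hact a ha
      obtain ⟨j, hj⟩ := hact b hb
      obtain ⟨k', hk'⟩ := hact a⁻¹ (inv_mem ha)
      have hinv : ∀ U ∈ s, a⁻¹ • U = g ^ (-k) • U := fun U hU => by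
        rw [inv_smul_eq_iff, hk _ (hmem _ U hU), smul_smul, ← zpow_add, add_neg_cancel,
          zpow_zero, one_smul]
      have hinv' : ∀ U ∈ s, b⁻¹ • U = g ^ (-j) • U := fun U hU => by
        rw [inv_smul_eq_iff, hj _ (hmem _ U hU), smul_smul, ← zpow_add, add_neg_cancel,
          zpow_zero, one_smul]
      rw [commutatorElement_def, mul_smul, mul_smul, mul_smul, hinv' W hW,
        hinv _ (hmem _ _ hW), hj _ (hmem _ _ (hmem _ _ hW)),
        hk _ (hmem _ _ (hmem _ _ (hmem _ _ hW)))]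
      simp only [smul_smul, ← zpow_add]
      rw [show k + (j + (-k + -j)) = 0 by ring, zpow_zero, one_smul]
    · intro a ha
      rw [mem_fixingSubgroup_iff]
      intro W hW
      obtain ⟨k, hk⟩ := hact a ha
      have hpow : ∀ m : ℕ, a ^ m • W = g ^ (k * m) • W := by
        intro m
        induction m with
        | zero => simp
        | succ m ih =>
          rw [pow_succ', mul_smul, ih, hk _ (hmem _ _ hW), smul_smul, ← zpow_add]
          congr 2
          push_cast
          ring
      rw [hpow, mul_comm, zpow_mul, zpow_natCast]
      exact UGroup.smul_eq_self_of_mem_scalarCircle (zpow_mem hgp k) W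
  obtain ⟨V, hV, W, hW, hne⟩ := hnt
  obtain ⟨k, hk⟩ := hcon V hV W hW
  rw [mem_fixingSubgroup_iff] at hgK
  apply hne
  rw [← hk]
  have : g ^ k ∈ fixingSubgroup (UGroup n) s :=
    zpow_mem ((mem_fixingSubgroup_iff _).2 hgK) k
  exact ((mem_fixingSubgroup_iff _).1 this V hV).symm

/-- Replaces infinitely many exponents by `p` of them, so that finitely many locally constant
conditions describe the orbit relation. -/
theorem exists_zpow_smul_eq_iff {p : ℕ} (hp : p ≠ 0) (hgp : g ^ p ∈ scalarCircle n)
    {V W : Submodule ℂ (CSpace n)} :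
    (∃ k : ℤ, g ^ k • V = W) ↔ ∃ k : Fin p, g ^ (k : ℕ) • V = W := by
  constructor
  · rintro ⟨k, rfl⟩
    have hp' : (p : ℤ) ≠ 0 := Int.natCast_ne_zero.2 hp
    have h0 := Int.emod_nonneg k hp'
    have h1 := Int.emod_lt_of_pos k (by omega : (0 : ℤ) < p)
    refine ⟨⟨(k % p).toNat, by omega⟩, ?_⟩
    change g ^ (k % p).toNat • V = g ^ k • V
    conv_rhs => rw [← Int.emod_add_mul_ediv k p, zpow_add, mul_smul, zpow_mul, zpow_natCast,
      UGroup.smul_eq_self_of_mem_scalarCircle (zpow_mem hgp _)]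
    rw [← zpow_natCast, Int.toNat_of_nonneg h0]
  · rintro ⟨k, rfl⟩
    exact ⟨k, by rw [zpow_natCast]⟩

open UPartition in
/-- On the tuples representing weakly fixed decompositions, the projections onto the orbit spans
are continuous. -/
theorem continuousAt_starProjection_orbitSpan {p : ℕ} (hp : p ≠ 0) (hg : g ∈ H)
    (hgp : g ^ p ∈ scalarCircle n) {m : ℕ} (hm : 1 < m)
    (v₀ : TupleOver (UPartition.IsWeaklyFixed (n := n) H) hm) (i : Fin m) :
    ContinuousAt (fun v : TupleOver (UPartition.IsWeaklyFixed (n := n) H) hm =>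
      (orbitSpan g (v.1 i).space).starProjection) v₀ := by
  classical
  have hfix : ∀ (v : TupleOver (UPartition.IsWeaklyFixed (n := n) H) hm) (i : Fin m), ∀ h ∈ H,
      ∃ j, (v.1 j).space = h • (v.1 i).space := fun v i h hh =>
    isWeaklyFixed_iff.1 v.toPartition.2 h hh _ ⟨i, rfl⟩
  have hpair : ∀ (v : TupleOver (UPartition.IsWeaklyFixed (n := n) H) hm) (i j : Fin m),
      i ≠ j → (v.1 i).space ⟂ (v.1 j).space := by
    intro v i j hij
    obtain ⟨σ, hσ, ho, -⟩ := v.2.choose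
    obtain ⟨τ, hτ⟩ : permSetoid (GrPos n) m σ v.1 := Quotient.exact hσ
    rw [hτ]
    exact ho _ _ fun h => hij (τ.injective h)
  have hev : ∀ᶠ v in 𝓝 v₀, ∀ (j : Fin m) (k : Fin p),
      (g ^ (k : ℕ) • (v.1 i).space = (v.1 j).space ↔
        g ^ (k : ℕ) • (v₀.1 i).space = (v₀.1 j).space) := by
    refine Filter.eventually_all.2 fun j => Filter.eventually_all.2 fun k =>
      eventually_eq_iff_of_orthogonal ?_
        (TupleOver.continuous_starProjection hm j).continuousAt fun v => ?_
    · simp only [UGroup.starProjection_smul]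
      exact ((continuous_const.clm_comp
        (TupleOver.continuous_starProjection hm i)).clm_comp continuous_const).continuousAt
    · obtain ⟨l, hl⟩ := hfix v i _ (pow_mem hg (k : ℕ))
      rw [← hl]
      by_cases h : l = j
      · exact Or.inl (by rw [h])
      · exact Or.inr (hpair v l j h)
  -- `S` is the orbit of `i` at `v₀`. It stays the orbit nearby, where the projection onto the orbit
  -- span is the sum of the projections indexed by this fixed set.
  let S : Finset (Fin m) :=
    Finset.univ.filter fun j => ∃ k : ℤ, g ^ k • (v₀.1 i).space = (v₀.1 j).space
  have hspan : ∀ᶠ v in 𝓝 v₀, ∑ j ∈ S, (v.1 j).space.starProjection =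
      (orbitSpan g (v.1 i).space).starProjection := by
    filter_upwards [hev] with v hv
    have hS : ∀ j, j ∈ S ↔ ∃ k : ℤ, g ^ k • (v.1 i).space = (v.1 j).space := by
      intro j
      simp only [S, Finset.mem_filter, Finset.mem_univ, true_and,
        exists_zpow_smul_eq_iff hp hgp, hv]
    rw [← starProjection_biSup (hpair v)]
    congr 1
    refine le_antisymm (iSup₂_le fun j hj => ?_) (iSup_le fun k => ?_)
    · obtain ⟨k, hk⟩ := (hS j).1 hj
      rw [← hk]
      exact le_iSup (fun k : ℤ => g ^ k • (v.1 i).space) k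
    · obtain ⟨j, hj⟩ := hfix v i _ (zpow_mem hg k)
      rw [← hj]
      exact le_iSup₂ (f := fun j (_ : j ∈ S) => (v.1 j).space) j ((hS j).2 ⟨k, hj.symm⟩)
  exact (continuous_finsetSum S fun j _ =>
    TupleOver.continuous_starProjection hm j).continuousAt.congr hspan

/-- A map on weakly fixed decompositions that coarsens by orbits is continuous. -/
theorem continuous_of_classes_eq_orbitCoarsening {p : ℕ} (hp : p ≠ 0) (hg : g ∈ H)
    (hgp : g ^ p ∈ scalarCircle n) {Φ : FixedPartition H → UPartition n}
    (hΦ : ∀ l, (Φ l).classes = orbitCoarsening g l.1.classes) : Continuous Φ := by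
  refine UPartition.continuous_of_tupleOver fun {m} hm v₀ => ?_
  refine UPartition.continuousAt_of_family (ι := Fin m)
    (V := fun v i => orbitSpan g (v.1 i).space) (fun i => ?_) fun v => ?_
  · exact continuousAt_starProjection_orbitSpan hp hg hgp hm v₀ i
  · have hbot := (Φ v.toPartition).isOrthogonalDecomposition_classes.bot_notMem
    rw [← Set.sdiff_singleton_eq_self hbot, hΦ, UPartition.TupleOver.classes_toPartition,
      orbitCoarsening, ← Set.range_comp]
    rfl

/-- A map on weakly fixed decompositions that coarsens by orbits and refines by eigenspaces is
continuous. -/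
theorem continuous_of_classes_eq_eigRefinement {p : ℕ} (hp : p ≠ 0) (hg : g ∈ H)
    (hgp : g ^ p ∈ scalarCircle n) {Φ : FixedPartition H → UPartition n}
    (hΦ : ∀ l, (Φ l).classes = eigRefinement g (orbitCoarsening g l.1.classes)) :
    Continuous Φ := by
  refine UPartition.continuous_of_tupleOver fun {m} hm v₀ => ?_
  have := (finite_nonzero_eigSpace g).to_subtype
  -- Only the finitely many eigenvalues of `g` are needed as indices, and `g` does not vary; zero
  -- intersections are discarded by the criterion.
  refine UPartition.continuousAt_of_family (ι := Fin m × {ζ : ℂ | eigSpace g ζ ≠ ⊥})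
    (V := fun v x => orbitSpan g (v.1 x.1).space ⊓ eigSpace g x.2) (fun x => ?_) fun v => ?_
  · have h := (continuousAt_starProjection_orbitSpan hp hg hgp hm v₀ x.1).clm_comp
      (continuousAt_const (y := (eigSpace g x.2).starProjection))
    refine h.congr (Filter.Eventually.of_forall fun v => ?_)
    exact (starProjection_inf_eigSpace (smul_self_orbitSpan _) _).symm
  · rw [hΦ, UPartition.TupleOver.classes_toPartition]
    ext U
    constructor
    · rintro ⟨⟨_, ⟨_, ⟨i, rfl⟩, rfl⟩, ζ, rfl⟩, hne⟩
      refine ⟨⟨(i, ⟨ζ, fun h0 => hne ?_⟩), rfl⟩, hne⟩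
      change orbitSpan g (v.1 i).space ⊓ eigSpace g ζ = ⊥
      rw [h0, inf_bot_eq]
    · rintro ⟨⟨⟨i, ζ⟩, rfl⟩, hne⟩
      exact ⟨⟨_, ⟨_, ⟨i, rfl⟩, rfl⟩, ζ, rfl⟩, hne⟩

/-- If some element of `H` is central of finite order modulo scalars, is not a scalar, and never
acts transitively on a weakly fixed decomposition, then the fixed point space is contractible. -/
theorem contractibleSpace_fixedSpace {p : ℕ} (hp : p ≠ 0) (hg : g ∈ H) (hns : g ∉ scalarCircle n)
    (hgp : g ^ p ∈ scalarCircle n) (hc : ∀ h ∈ H, (h * g)⁻¹ * (g * h) ∈ scalarCircle n)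
    (hnt : ∀ l : FixedPartition H, ∃ V ∈ l.1.classes, ∃ W ∈ l.1.classes,
      ∀ k : ℤ, g ^ k • V ≠ W) : ContractibleSpace (FixedSpace H) := by
  have htop := iSup_eigSpace hp hgp
  have hinv : ∀ l : FixedPartition H, ∀ h ∈ H, ∀ V ∈ l.1.classes, h • V ∈ l.1.classes :=
    fun l => UPartition.isWeaklyFixed_iff.1 l.2
  have hdec := fun l : FixedPartition H => l.1.isOrthogonalDecomposition_classes
  have hG := fun l : FixedPartition H => isOrthogonalDecomposition_orbitCoarsening (hdec l)
    (fun k V hV => hinv l _ (zpow_mem hg k) V hV) (hnt l)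
  have hR := fun l : FixedPartition H => isOrthogonalDecomposition_eigRefinement (g := g) (hG l)
    (by rintro _ ⟨V, -, rfl⟩; exact smul_self_orbitSpan V) htop
  have hE := isOrthogonalDecomposition_eigDecomposition hns htop
  have hGfix : ∀ l, (UPartition.ofClasses _ (hG l)).IsWeaklyFixed H := by
    intro l
    rw [UPartition.isWeaklyFixed_iff, UPartition.classes_ofClasses]
    rintro h hh _ ⟨V, hV, rfl⟩
    exact ⟨h • V, hinv l h hh V hV, (smul_orbitSpan (hc h hh) V).symm⟩
  have hRfix : ∀ l, (UPartition.ofClasses _ (hR l)).IsWeaklyFixed H := by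
    intro l
    rw [UPartition.isWeaklyFixed_iff, UPartition.classes_ofClasses]
    rintro h hh _ ⟨⟨_, ⟨V, hV, rfl⟩, ζ, rfl⟩, hne⟩
    obtain ⟨ξ, hξ⟩ := smul_eigSpace (hc h hh) ζ
    refine ⟨⟨_, ⟨h • V, hinv l h hh V hV, rfl⟩, ξ, ?_⟩, fun h0 => hne (UGroup.smul_eq_bot_iff.1 h0)⟩
    rw [← hξ, ← smul_orbitSpan (hc h hh), UGroup.smul_inf]
  have hEfix : (UPartition.ofClasses _ hE).IsWeaklyFixed H := by
    rw [UPartition.isWeaklyFixed_iff, UPartition.classes_ofClasses]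
    rintro h hh _ ⟨⟨ζ, rfl⟩, hne⟩
    obtain ⟨ξ, hξ⟩ := smul_eigSpace (hc h hh) ζ
    exact ⟨⟨ξ, hξ.symm⟩, fun h0 => hne (UGroup.smul_eq_bot_iff.1 h0)⟩
  let G : FixedPartition H → FixedPartition H := fun l => ⟨UPartition.ofClasses _ (hG l), hGfix l⟩
  let R : FixedPartition H → FixedPartition H := fun l => ⟨UPartition.ofClasses _ (hR l), hRfix l⟩
  have hGcl : ∀ l, (G l).1.classes = orbitCoarsening g l.1.classes := fun l =>
    UPartition.classes_ofClasses _ (hG l)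
  have hRcl : ∀ l, (R l).1.classes = eigRefinement g (orbitCoarsening g l.1.classes) := fun l =>
    UPartition.classes_ofClasses _ (hR l)
  refine NerveRealization.contractibleSpace_of_zigzag (φ := G) (ψ := R)
    ⟨UPartition.ofClasses _ hE, hEfix⟩ ?_ ?_ ?_ ?_ ?_ ?_ ?_
  · intro l l' hll' U hU
    rw [hGcl] at hU ⊢
    obtain ⟨V, hV, rfl⟩ := hU
    obtain ⟨W, hW, hVW⟩ := hll' V hV
    exact ⟨_, ⟨W, hW, rfl⟩, orbitSpan_mono hVW⟩
  · intro l l' hll' U hU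
    rw [hRcl] at hU ⊢
    obtain ⟨⟨_, ⟨V, hV, rfl⟩, ζ, rfl⟩, hne⟩ := hU
    obtain ⟨W, hW, hVW⟩ := hll' V hV
    have hle : orbitSpan g V ⊓ eigSpace g ζ ≤ orbitSpan g W ⊓ eigSpace g ζ :=
      inf_le_inf_right _ (orbitSpan_mono hVW)
    exact ⟨_, ⟨⟨_, ⟨W, hW, rfl⟩, ζ, rfl⟩, fun h0 => hne (le_bot_iff.1 (hle.trans h0.le))⟩, hle⟩
  · exact (continuous_of_classes_eq_orbitCoarsening hp hg hgp hGcl).subtype_mk _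
  · exact (continuous_of_classes_eq_eigRefinement hp hg hgp hRcl).subtype_mk _
  · intro l V hV
    rw [hGcl]
    exact ⟨_, ⟨V, hV, rfl⟩, le_orbitSpan V⟩
  · intro l U hU
    rw [hRcl] at hU
    rw [hGcl]
    obtain ⟨⟨W, hW, ζ, rfl⟩, -⟩ := hU
    exact ⟨W, hW, inf_le_left⟩
  · intro l U hU
    rw [hRcl] at hU
    obtain ⟨⟨W, hW, ζ, rfl⟩, hne⟩ := hU
    refine ⟨eigSpace g ζ, ?_, inf_le_right⟩
    rw [UPartition.classes_ofClasses]
    refine ⟨⟨ζ, rfl⟩, fun h0 => hne ?_⟩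
    change W ⊓ eigSpace g ζ = ⊥
    rw [show eigSpace g ζ = ⊥ from h0, inf_bot_eq]

end Fixed

end

/-! ### The main theorem -/

theorem theorem1p1 (p : ℕ) (hp : p.Prime) (n : ℕ) (H : Subgroup (UGroup n))
    (hclosed : IsClosed (H : Set (UGroup n))) (htoral : IsPToral p H)
    (hfix : ¬ ContractibleSpace (FixedSpace H)) :
    IsElementaryAbelian p (projImage H) := by
  by_contra hne
  obtain ⟨g, hg, hns, hgp, hc, hK⟩ := exists_central_of_not_isElementaryAbelian hp htoral hne
  refine hfix (contractibleSpace_fixedSpace hp.ne_zero hg hns hgp hc fun l => ?_)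
  exact exists_not_same_orbit hg hgp hc hK (UPartition.isWeaklyFixed_iff.1 l.2)
    l.1.isOrthogonalDecomposition_classes.nontrivial
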